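/- Let $K$ be an algebraically closed field, let $V$ be a finite-dimensional $K$-vector space, and let $\mathrm{Lie}(V)\subseteq\operatorname{Hom}_K(\Lambda^2V,V)$ be the variety of Lie algebra structures on $V$, i.e. of the alternating bilinear maps $V\times V\to V$ satisfying the Jacobi identity. The group $\mathrm{GL}(V)$ acts on it by $(g\cdot\varphi)(a,b)=g\,\varphi(g^{-1}a,g^{-1}b)$. Let $\mathfrak g$ and $\mathfrak h$ be Lie algebras over $K$ of dimension $\dim_K V$, regarded as points of $\mathrm{Lie}(V)$ through linear isomorphisms $\mathfrak g\cong V$ and $\mathfrak h\cong V$, and let $O_{\mathfrak g}$, $O_{\mathfrak h}$ be the $\mathrm{GL}(V)$-orbits of these points. The Lie algebra $\mathfrak h$ is called a degeneration of $\mathfrak g$ if $O_{\mathfrak h}\subseteq\overline{O_{\mathfrak g}}$, the Zariski closure of $O_{\mathfrak g}$ in $\mathrm{Lie}(V)$. A Gerstenhaber formal deformation of $\mathfrak h$ is a Lie algebra $\tilde X$ over $K[[t]]$ that is $t$-adically complete (and separated) and torsion-free as a $K[[t]]$-module, together with an isomorphism of Lie algebras over $K$ from $\tilde X\otimes_{K[[t]]}K$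 to $\mathfrak h$, where $K$ is a $K[[t]]$-algebra through $t\mapsto 0$. Then $\mathfrak h$ is a degeneration of $\mathfrak g$ if and only if $\mathfrak h$ has a Gerstenhaber formal deformation $\tilde X$ such that $\tilde X\otimes_{K[[t]]}K((t))\cong\mathfrak g\otimes_K K((t))$ as Lie algebras over $K((t))$. -/

import Mathlib

open scoped TensorProduct PowerSeries LaurentSeries

universe u v w x y

noncomputable section

namespace LieDegeneration

/-! ### The variety of Lie algebra structures, its `GL(V)`-orbits and their Zariski closures -/

/-- Bilinear maps `V × V → V`. -/
abbrev Bilin (K : Type u) [Field K] (V : Type v) [AddCommGroup V] [Module K V] : Type v :=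
  V →ₗ[K] V →ₗ[K] V

/-- The variety of Lie algebra structures on `V`: the alternating bilinear maps
(that is, the linear maps `Λ² V → V`) that satisfy the Jacobi identity. -/
def lieVariety (K : Type u) [Field K] (V : Type v) [AddCommGroup V] [Module K V] :
    Set (Bilin K V) :=
  {φ | (∀ a, φ a a = 0) ∧
    ∀ a b c, φ a (φ b c) + φ b (φ c a) + φ c (φ a b) = 0}

/-- Transport of a bilinear structure along a linear isomorphism `e`:
`(a, b) ↦ e (φ (e⁻¹ a) (e⁻¹ b))`. For `e ∈ GL(V)` this is the action of `GL(V)`. -/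
def transport {K : Type u} [Field K] {V : Type v} [AddCommGroup V] [Module K V]
    {W : Type w} [AddCommGroup W] [Module K W] (e : V ≃ₗ[K] W) (φ : Bilin K V) : Bilin K W :=
  (φ.compl₁₂ e.symm.toLinearMap e.symm.toLinearMap).compr₂ e.toLinearMap

theorem transport_apply {K : Type u} [Field K] {V : Type v} [AddCommGroup V] [Module K V]
    {W : Type w} [AddCommGroup W] [Module K W] (e : V ≃ₗ[K] W) (φ : Bilin K V) (a b : W) :
    transport e φ a b = e (φ (e.symm a) (e.symm b)) := rfl

/-- The `GL(V)`-orbit of `φ`. -/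
def orbit {K : Type u} [Field K] {V : Type v} [AddCommGroup V] [Module K V]
    (φ : Bilin K V) : Set (Bilin K V) :=
  {ψ | ∃ g : V ≃ₗ[K] V, ψ = transport g φ}

/-- The Zariski closure of a subset `S` of a finite dimensional vector space `W`: the common
zeros of all polynomial functions on `W` that vanish on `S`. A polynomial function is
the evaluation of a polynomial expression in linear functionals on `W`. -/
def zariskiClosure (K : Type u) [Field K] {W : Type v} [AddCommGroup W] [Module K W]
    (S : Set W) : Set W :=
  {y | ∀ p : MvPolynomial (Module.Dual K W) K,
    (∀ s ∈ S, MvPolynomial.eval (fun l => l s) p = 0) →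
      MvPolynomial.eval (fun l => l y) p = 0}

/-- `ψ` is a degeneration of `φ` (for points of the variety of Lie algebra structures on `V`):
the orbit of `ψ` is contained in the Zariski closure, inside that variety,
of the orbit of `φ`. -/
def IsDegeneration {K : Type u} [Field K] {V : Type v} [AddCommGroup V] [Module K V]
    (ψ φ : Bilin K V) : Prop :=
  orbit ψ ⊆ lieVariety K V ∩ zariskiClosure K (orbit φ)

/-- The point of the variety of Lie algebra structures on `V` given by a Lie algebra `L`
whose underlying vector space is identified with `V` by `e`. -/
def point {K : Type u} [Field K] {L : Type w} [LieRing L] [LieAlgebra K L]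
    {V : Type v} [AddCommGroup V] [Module K V] (e : L ≃ₗ[K] V) : Bilin K V :=
  transport e (LieAlgebra.ad K L : L →ₗ[K] Module.End K L)

theorem point_apply {K : Type u} [Field K] {L : Type w} [LieRing L] [LieAlgebra K L]
    {V : Type v} [AddCommGroup V] [Module K V] (e : L ≃ₗ[K] V) (a b : V) :
    point e a b = e ⁅e.symm a, e.symm b⁆ := rfl

/-! ### Gerstenhaber formal deformations -/

/-- `K` as a `K⟦X⟧`-algebra, through the specialization at `0`. -/
abbrev specializationAlgebra (K : Type u) [Field K] : Algebra K⟦X⟧ K :=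
  (PowerSeries.constantCoeff (R := K)).toAlgebra

attribute [local instance] specializationAlgebra

/-- `A ⊗ L` as a Lie algebra over `A`, for a commutative `R`-algebra `A`
and a Lie algebra `L` over `R`. -/
abbrev ScalarExtension (R : Type u) (A : Type v) (L : Type w) [CommRing R] [CommRing A]
    [Algebra R A] [LieRing L] [LieAlgebra R L] : Type (max v w) :=
  A ⊗[R] L

/-- A Gerstenhaber formal deformation of a Lie algebra `L` over `K`: a complete
(for the `X`-adic topology, including separated) and torsion-free Lie algebra over `K⟦X⟧`,
with an isomorphism of Lie algebras over `K` from its specialization at `0` to `L`. -/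
structure FormalDeformation (K : Type u) [Field K] (L : Type w) [LieRing L] [LieAlgebra K L] where
  carrier : Type x
  [lieRing : LieRing carrier]
  [lieAlgebra : LieAlgebra K⟦X⟧ carrier]
  complete : IsAdicComplete (Ideal.span {(PowerSeries.X : K⟦X⟧)}) carrier
  torsionFree : Module.IsTorsionFree K⟦X⟧ carrier
  specialization : ScalarExtension K⟦X⟧ K carrier ≃ₗ⁅K⁆ L

attribute [instance] FormalDeformation.lieRing FormalDeformation.lieAlgebra

end LieDegeneration

end

/-!
The orbit of `𝔤` is the image of a morphism from `GL(V)`, and the theorem is a curve selection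
statement for this morphism: `𝔥` lies in the closure of the orbit if and only if it is the value
at `0` of a curve of structure constants over `K⟦X⟧` that, over `K⸨X⸩`, is a translate of the
structure constants of `𝔤` by an invertible matrix (`mem_zariskiClosure_orbit_iff`). Such a curve
is the same thing as a formal deformation of `𝔥` that is generically isomorphic to `𝔤`: the curve
defines a bracket on a free `K⟦X⟧`-module (`exists_formalDeformation`), and conversely lifts of a
basis of `𝔥` form a basis of the deformation (`exists_curve_of_formalDeformation`).

If there is such a curve, then a polynomial that vanishes on the orbit vanishes at the generic
point of `GL(V)`, hence at its `K⸨X⸩`-points, hence along the curve.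

The existence of the curve is the substance (`exists_algHom_laurentSeries`). Let `A → B` be the
homomorphism from the coordinate ring of the structure constants to a polynomial ring that is
given by the generic point of the orbit (`genericConst`). A valuation ring `W` of `Frac B`
dominates the image of `A` at the point `𝔥`. Each generator of `B`, or its inverse, is in `W`, and
so, together with the image of `A`, these elements generate an affine algebra `C ⊆ W` with a
closed point over `𝔥` such that `B` is contained in `C[1/f]` for some `f ≠ 0`. It remains to find
a formal arc of `Spec C` through the closed point along which `f` does not vanish. To do so,
divide by a prime that is maximal among the primes inside the closed point which do not contain
`f`. The quotient has dimension at most one by Krull's principal ideal theorem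
(`krullDimLE_one_of_forall_mem_prime`), a valuation ring that dominates it is discrete by an
argument of Krull and Akizuki (`isNoetherianRing_of_le_fractionField`) with residue field `K`, and
elements of such a ring have power series expansions (`exists_algHom_powerSeries`). As `B` is
contained in `C[1/f]`, the arc lifts to `B` without a ramified base change.
-/

/-! ### Power series expansions in a discrete valuation ring -/

namespace LieDegeneration

open IsLocalRing

/-- Power series expansion: a discrete valuation ring that contains a field mapping onto its
residue field embeds into the power series ring over that field. The coefficients of `x` are found
by writing `x = k x + s * y x` with `s` a uniformizer and iterating `y`. -/
theorem exists_algHom_powerSeries {K : Type*} {V : Type*} [Field K] [CommRing V] [IsDomain V]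
    [IsDiscreteValuationRing V] [Algebra K V]
    (hres : ∀ x : V, ∃ k : K, x - algebraMap K V k ∈ maximalIdeal V) :
    ∃ φ : V →ₐ[K] K⟦X⟧, Function.Injective φ ∧
      ∀ x ∈ maximalIdeal V, PowerSeries.constantCoeff (φ x) = 0 := by
  obtain ⟨s, hs⟩ := IsDiscreteValuationRing.exists_irreducible V
  have hmax : maximalIdeal V = Ideal.span {s} := hs.maximalIdeal_eq
  have hs0 : s ≠ 0 := hs.ne_zero
  have hex : ∀ x : V, ∃ k : K, ∃ y : V, x = algebraMap K V k + s * y := by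
    intro x
    obtain ⟨k, h⟩ := hres x
    rw [hmax, Ideal.mem_span_singleton'] at h
    obtain ⟨y, hy⟩ := h
    exact ⟨k, y, by linear_combination -hy⟩
  have huniq : ∀ {k k' : K} {y y' : V},
      algebraMap K V k + s * y = algebraMap K V k' + s * y' → k = k' ∧ y = y' := by
    intro k k' y y' h
    have hk : k = k' := by
      by_contra hne
      have hu : IsUnit (algebraMap K V (k - k')) :=
        (IsUnit.mk0 _ (sub_ne_zero.2 hne)).map _
      have hm : algebraMap K V (k - k') ∈ maximalIdeal V := by
        rw [hmax, Ideal.mem_span_singleton', map_sub]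
        exact ⟨y' - y, by linear_combination -h⟩
      exact (mem_maximalIdeal _).1 hm hu
    subst hk
    exact ⟨rfl, mul_left_cancel₀ hs0 (add_left_cancel h)⟩
  choose k y hky using hex
  have hk_add : ∀ a b, k (a + b) = k a + k b ∧ y (a + b) = y a + y b := fun a b ↦ by
    apply huniq
    rw [← hky, map_add]
    linear_combination hky a + hky b
  have hk_mul : ∀ a b, k (a * b) = k a * k b ∧
      y (a * b) = algebraMap K V (k a) * y b + y a * b := fun a b ↦ by
    apply huniq
    rw [← hky, map_mul]
    linear_combination b * hky a + algebraMap K V (k a) * hky b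
  have hk_alg : ∀ c, k (algebraMap K V c) = c ∧ y (algebraMap K V c) = 0 := fun c ↦ by
    apply huniq
    rw [← hky]
    ring
  let φ : V → K⟦X⟧ := fun x ↦ PowerSeries.mk fun n ↦ k (y^[n] x)
  have hφ0 : ∀ x, PowerSeries.coeff 0 (φ x) = k x := fun x ↦ by simp [φ]
  have hφs : ∀ n x, PowerSeries.coeff (n + 1) (φ x) = PowerSeries.coeff n (φ (y x)) :=
    fun n x ↦ by simp [φ]
  have hφ_rec : ∀ x, φ x = PowerSeries.C (k x) + PowerSeries.X * φ (y x) := fun x ↦ by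
    ext (_ | n)
    · simp [hφ0]
    · rw [hφs, map_add, PowerSeries.coeff_succ_X_mul]
      simp
  have hφ_add : ∀ a b, φ (a + b) = φ a + φ b := fun a b ↦ by
    ext n
    induction n generalizing a b with
    | zero => simp only [map_add, hφ0, (hk_add a b).1]
    | succ n ih => rw [map_add, hφs, hφs, hφs, (hk_add a b).2, ih, map_add]
  have hφ_alg : ∀ c, φ (algebraMap K V c) = PowerSeries.C c := fun c ↦ by
    have h0 : φ 0 = 0 := by simpa using hφ_add 0 0
    rw [hφ_rec, (hk_alg c).1, (hk_alg c).2, h0, mul_zero, add_zero]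
  have hφ_mul : ∀ a b, φ (a * b) = φ a * φ b := fun a b ↦ by
    have hC : ∀ (c : K) (b : V) (n : ℕ), PowerSeries.coeff n (φ (algebraMap K V c * b)) =
        c * PowerSeries.coeff n (φ b) := by
      intro c b n
      induction n generalizing b with
      | zero => rw [hφ0, hφ0, (hk_mul _ _).1, (hk_alg c).1]
      | succ n ih => rw [hφs, hφs, (hk_mul _ _).2, (hk_alg c).1, (hk_alg c).2, zero_mul, add_zero,
          ih]
    ext n
    induction n generalizing a b with
    | zero => rw [hφ0, PowerSeries.coeff_zero_eq_constantCoeff_apply, map_mul,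
        ← PowerSeries.coeff_zero_eq_constantCoeff_apply,
        ← PowerSeries.coeff_zero_eq_constantCoeff_apply, hφ0, hφ0, (hk_mul a b).1]
    | succ n ih =>
      rw [hφs, (hk_mul a b).2, hφ_add, map_add, hC, ih, hφ_rec a, add_mul, mul_assoc, map_add,
        PowerSeries.coeff_succ_X_mul, PowerSeries.coeff_C_mul, hφs]
  refine ⟨{ toFun := φ
            map_one' := by simpa using hφ_alg 1
            map_mul' := hφ_mul
            map_zero' := by simpa using hφ_alg 0
            map_add' := hφ_add
            commutes' := hφ_alg }, ?_, ?_⟩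
  · rw [injective_iff_map_eq_zero]
    intro x hx
    change φ x = 0 at hx
    have hdvd : ∀ n, ∀ x, φ x = 0 → s ^ n ∣ x := by
      intro n
      induction n with
      | zero => simp
      | succ n ih =>
        intro x hx
        have hkx : k x = 0 := by rw [← hφ0, hx, map_zero]
        have hyx : φ (y x) = 0 := by
          ext m
          rw [← hφs, hx]
          simp
        rw [hky x, hkx, map_zero, zero_add, pow_succ']
        exact mul_dvd_mul_left s (ih _ hyx)
    by_contra hx0
    exact (FiniteMultiplicity.of_not_isUnit hs.not_isUnit hx0).not_pow_dvd_of_multiplicity_lt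
      (Nat.lt_succ_self _) (hdvd _ x hx)
  · intro x hx
    change PowerSeries.constantCoeff (φ x) = 0
    rw [← PowerSeries.coeff_zero_eq_constantCoeff_apply, hφ0]
    rw [hmax, Ideal.mem_span_singleton'] at hx
    obtain ⟨z, rfl⟩ := hx
    refine (huniq (k := k (z * s)) (y := y (z * s)) (k' := 0) (y' := z) ?_).1
    rw [← hky, map_zero]
    ring

/-! ### Valuation rings dominating a one-dimensional Noetherian domain -/

/-- For a submodule `N` of `M` of finite colength on which a nonzerodivisor `a` acts, `N / aN` and
`M / aM` have the same length: both differ from the length of `M / aN` by that of `M / N`. -/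
theorem length_quotient_range_lsmul_eq {R N M : Type*} [CommRing R] [AddCommGroup N] [Module R N]
    [AddCommGroup M] [Module R M] (j : N →ₗ[R] M) (hj : Function.Injective j) (a : R)
    (ha : Function.Injective (LinearMap.lsmul R M a))
    (hfin : Module.length R (M ⧸ LinearMap.range j) ≠ ⊤) :
    Module.length R (N ⧸ LinearMap.range (LinearMap.lsmul R N a)) =
      Module.length R (M ⧸ LinearMap.range (LinearMap.lsmul R M a)) := by
  set Q : Submodule R M := LinearMap.range (j ∘ₗ LinearMap.lsmul R N a)
  have hQj : Q ≤ LinearMap.range j := LinearMap.range_comp_le_range _ _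
  have hQa : Q ≤ LinearMap.range (LinearMap.lsmul R M a) := by
    rintro _ ⟨n, rfl⟩
    exact ⟨j n, by simp⟩
  have h₁ : LinearMap.range (LinearMap.lsmul R N a) ≤ Q.comap j := by
    rintro _ ⟨n, rfl⟩
    exact ⟨n, rfl⟩
  have h₂ : LinearMap.range j ≤ Q.comap (LinearMap.lsmul R M a) := by
    rintro _ ⟨n, rfl⟩
    exact ⟨n, by simp⟩
  have e₁ := Module.length_eq_add_of_exact (Submodule.mapQ _ Q j h₁) (Submodule.factor hQj)
    (by
      rw [injective_iff_map_eq_zero]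
      intro x hx
      obtain ⟨n, rfl⟩ := Submodule.mkQ_surjective _ x
      rw [Submodule.mkQ_apply, Submodule.mapQ_apply, Submodule.Quotient.mk_eq_zero] at hx
      rw [Submodule.mkQ_apply, Submodule.Quotient.mk_eq_zero]
      obtain ⟨m, hm⟩ := hx
      exact ⟨m, hj hm⟩)
    (Submodule.factor_surjective hQj)
    (by
      intro x
      obtain ⟨m, rfl⟩ := Submodule.mkQ_surjective _ x
      rw [Submodule.factor_mk, Submodule.mkQ_apply, Submodule.mkQ_apply,
        Submodule.Quotient.mk_eq_zero]
      constructor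
      · rintro ⟨n, rfl⟩
        exact ⟨Submodule.Quotient.mk n, Submodule.mapQ_apply ..⟩
      · rintro ⟨y, hy⟩
        obtain ⟨n, rfl⟩ := Submodule.mkQ_surjective _ y
        rw [Submodule.mkQ_apply, Submodule.mapQ_apply, Submodule.Quotient.eq] at hy
        have := Submodule.sub_mem _ (LinearMap.mem_range_self j n) (hQj hy)
        simpa using this)
  have e₂ := Module.length_eq_add_of_exact (Submodule.mapQ _ Q _ h₂) (Submodule.factor hQa)
    (by
      rw [injective_iff_map_eq_zero]
      intro x hx
      obtain ⟨n, rfl⟩ := Submodule.mkQ_surjective _ x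
      rw [Submodule.mkQ_apply, Submodule.mapQ_apply, Submodule.Quotient.mk_eq_zero] at hx
      rw [Submodule.mkQ_apply, Submodule.Quotient.mk_eq_zero]
      obtain ⟨m, hm⟩ := hx
      exact ⟨m, ha (by simpa using hm)⟩)
    (Submodule.factor_surjective hQa)
    (by
      intro x
      obtain ⟨m, rfl⟩ := Submodule.mkQ_surjective _ x
      rw [Submodule.factor_mk, Submodule.mkQ_apply, Submodule.mkQ_apply,
        Submodule.Quotient.mk_eq_zero]
      constructor
      · rintro ⟨n, rfl⟩
        exact ⟨Submodule.Quotient.mk n, Submodule.mapQ_apply ..⟩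
      · rintro ⟨y, hy⟩
        obtain ⟨n, rfl⟩ := Submodule.mkQ_surjective _ y
        rw [Submodule.mkQ_apply, Submodule.mapQ_apply, Submodule.Quotient.eq] at hy
        have := Submodule.sub_mem _ (LinearMap.mem_range_self (LinearMap.lsmul R M a) n) (hQa hy)
        simpa using this)
  rw [e₁, add_comm] at e₂
  exact (ENat.add_right_injective_of_ne_top hfin) e₂

theorem isNoetherian_of_forall_fg_length_le {R M : Type*} [CommRing R] [AddCommGroup M] [Module R M]
    {ℓ : ℕ∞} (hℓ : ℓ ≠ ⊤) (h : ∀ N : Submodule R M, N.FG → Module.length R N ≤ ℓ) :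
    IsNoetherian R M := by
  refine ⟨fun P ↦ ?_⟩
  by_contra hP
  have key : ∀ n : ℕ, ∃ N : Submodule R M, N.FG ∧ N ≤ P ∧ (n : ℕ∞) ≤ Module.length R N := by
    intro n
    induction n with
    | zero => exact ⟨⊥, Submodule.fg_bot, bot_le, by simp⟩
    | succ n ih =>
      obtain ⟨N, hN, hNP, hn⟩ := ih
      have hlt : N < P := lt_of_le_of_ne hNP (by rintro rfl; exact hP hN)
      obtain ⟨x, hxP, hxN⟩ := SetLike.exists_of_lt hlt
      refine ⟨N ⊔ Submodule.span R {x}, hN.sup (Submodule.fg_span_singleton x),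
        sup_le hNP (by simpa using hxP), ?_⟩
      have hlt' : N < N ⊔ Submodule.span R {x} := by
        refine lt_of_le_of_ne le_sup_left fun he ↦ hxN ?_
        rw [he]
        exact Submodule.mem_sup_right (Submodule.mem_span_singleton_self x)
      have hfin : Module.length R N ≠ ⊤ := fun ht ↦ hℓ (top_le_iff.1 (ht ▸ h N hN))
      rw [Module.length_submodule] at hn hfin ⊢
      have := Order.height_strictMono hlt' (lt_top_iff_ne_top.2 hfin)
      push_cast
      exact (add_le_add_left hn 1).trans (Order.add_one_le_of_lt this)
  obtain ⟨n, rfl⟩ := ENat.ne_top_iff_exists.1 hℓ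
  obtain ⟨N, hN, -, hn⟩ := key (n + 1)
  have := hn.trans (h N hN)
  norm_cast at this
  omega

/-- A finitely generated `R`-submodule of the fraction field has finite length over `R`: a common
denominator `d` kills the quotient, which is therefore a quotient of a power of `R / d`. -/
theorem length_quotient_range_algebraMap_ne_top {R V : Type*} [CommRing R] [IsDomain R]
    [IsNoetherianRing R] [Ring.KrullDimLE 1 R] [CommRing V] [Algebra R V]
    (hfrac : ∀ v : V, ∃ c : R, c ≠ 0 ∧ ∃ r : R, c • v = algebraMap R V r)
    (M : Submodule R V) (hM : M.FG) (j : R →ₗ[R] M)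
    (hj : ∀ r, (j r : V) = algebraMap R V r) :
    Module.length R (M ⧸ LinearMap.range j) ≠ ⊤ := by
  classical
  obtain ⟨s, rfl⟩ := hM
  choose c hc0 r hr using hfrac
  set d : R := ∏ v ∈ s, c v
  have hd : d ∈ nonZeroDivisors R :=
    mem_nonZeroDivisors_of_ne_zero (Finset.prod_ne_zero_iff.2 fun v _ ↦ hc0 v)
  have hfl := isFiniteLength_quotient_span_singleton R hd
  rw [isFiniteLength_iff_isNoetherian_isArtinian] at hfl
  obtain ⟨hno, har⟩ := hfl
  -- multiplication by `d` takes each generator into the image of `R`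
  let g : s → R →ₗ[R] (Submodule.span R (s : Set V) ⧸ LinearMap.range j) := fun v ↦
    LinearMap.toSpanSingleton R _
      (Submodule.Quotient.mk ⟨v.1, Submodule.subset_span v.2⟩)
  have hg : ∀ v, Ideal.span {d} ≤ LinearMap.ker (g v) := by
    intro v
    rw [Ideal.span_le, Set.singleton_subset_iff, SetLike.mem_coe, LinearMap.mem_ker,
      LinearMap.toSpanSingleton_apply, ← Submodule.Quotient.mk_smul, Submodule.Quotient.mk_eq_zero]
    obtain ⟨e, he⟩ := Finset.dvd_prod_of_mem c v.2
    refine ⟨e * r v.1, Subtype.ext ?_⟩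
    rw [hj, map_mul, ← hr, Submodule.coe_smul, ← Algebra.smul_def, smul_smul, mul_comm]
    change (c v.1 * e) • _ = _
    rw [← he]
  let G : (s → R ⧸ Ideal.span {d}) →ₗ[R] (Submodule.span R (s : Set V) ⧸ LinearMap.range j) :=
    LinearMap.lsum R _ R fun v ↦ (Ideal.span {d}).liftQ (g v) (hg v)
  have hG : Function.Surjective G := by
    rw [← LinearMap.range_eq_top, eq_top_iff]
    rintro x -
    obtain ⟨⟨x, hx⟩, rfl⟩ := Submodule.mkQ_surjective _ x
    induction hx using Submodule.span_induction with
    | mem x h =>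
      refine ⟨Pi.single ⟨x, h⟩ (Submodule.Quotient.mk 1), ?_⟩
      simp only [G, LinearMap.lsum_piSingle, Submodule.liftQ_apply]
      simp [g]
    | zero => exact Submodule.zero_mem _
    | add x y hx hy h₁ h₂ => exact Submodule.add_mem _ h₁ h₂
    | smul a x hx h => exact Submodule.smul_mem _ a h
  exact ne_top_of_le_ne_top Module.length_ne_top (Module.length_le_of_surjective G hG)

section

variable {R V : Type*} [CommRing R] [IsDomain R] [IsNoetherianRing R] [Ring.KrullDimLE 1 R]
  [CommRing V] [IsDomain V] [Algebra R V] [FaithfulSMul R V]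

theorem length_quotient_lsmul_eq_ord
    (hfrac : ∀ v : V, ∃ c : R, c ≠ 0 ∧ ∃ r : R, c • v = algebraMap R V r)
    {a : R} (ha : a ≠ 0) (M : Submodule R V) (hM : M.FG) (h1 : (1 : V) ∈ M) :
    Module.length R (M ⧸ LinearMap.range (LinearMap.lsmul R M a)) = Ring.ord R a := by
  have hinj : Function.Injective (algebraMap R V) := FaithfulSMul.algebraMap_injective R V
  let j : R →ₗ[R] M := LinearMap.toSpanSingleton R M ⟨1, h1⟩
  have hj : ∀ r, (j r : V) = algebraMap R V r := fun r ↦ by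
    simp [j, Algebra.smul_def]
  have hsmul : Function.Injective (LinearMap.lsmul R M a) := fun m m' h ↦ by
    have h' := congrArg Subtype.val h
    simp only [LinearMap.lsmul_apply, Submodule.coe_smul, Algebra.smul_def] at h'
    exact Subtype.ext (mul_left_cancel₀ ((map_ne_zero_iff _ hinj).2 ha) h')
  have hord : LinearMap.range (LinearMap.lsmul R R a) = Ideal.span {a} := by
    ext x
    simp [Ideal.mem_span_singleton', mul_comm]
  rw [← length_quotient_range_lsmul_eq j (fun r r' h ↦ hinj (by rw [← hj, ← hj, h])) a hsmul
    (length_quotient_range_algebraMap_ne_top hfrac M hM j hj), hord, Ring.ord]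

/-- The key step of the Krull–Akizuki theorem, for a ring `V` between a one-dimensional Noetherian
domain `R` and its fraction field: the finitely generated submodules of `V / aV` are quotients of
`M / aM`, with `M` finitely generated over `R`, so that their length is at most that of `R / aR`.
-/
theorem isNoetherian_quotient_span_algebraMap
    (hfrac : ∀ v : V, ∃ c : R, c ≠ 0 ∧ ∃ r : R, c • v = algebraMap R V r)
    {a : R} (ha : a ≠ 0) :
    IsNoetherian R (V ⧸ Ideal.span {algebraMap R V a}) := by
  refine isNoetherian_of_forall_fg_length_le (ℓ := Ring.ord R a)
    (Ring.ord_ne_top (mem_nonZeroDivisors_of_ne_zero ha)) fun N hN ↦ ?_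
  obtain ⟨π, hπ, hπa⟩ : ∃ π : V →ₗ[R] (V ⧸ Ideal.span {algebraMap R V a}),
      Function.Surjective π ∧ ∀ v, π (a • v) = 0 := by
    refine ⟨(Ideal.Quotient.mkₐ R _).toLinearMap, Ideal.Quotient.mk_surjective, fun v ↦ ?_⟩
    refine Ideal.Quotient.eq_zero_iff_mem.2 (Ideal.mem_span_singleton'.2 ⟨v, ?_⟩)
    rw [Algebra.smul_def, mul_comm]
  obtain ⟨M₀, hM₀, hM₀N⟩ : ∃ M₀ : Submodule R V, M₀.FG ∧ M₀.map π = N := by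
    obtain ⟨s, rfl⟩ := hN
    refine ⟨Submodule.span R (Function.surjInv hπ '' s), ?_, ?_⟩
    · exact Submodule.fg_span (s.finite_toSet.image _)
    · rw [Submodule.map_span, Set.image_image]
      simp [Function.surjInv_eq hπ]
  -- enlarged by `1`, the submodule contains the image of `R` with finite colength
  set M : Submodule R V := M₀ ⊔ Submodule.span R {1}
  have hM : M.FG := hM₀.sup (Submodule.fg_span_singleton 1)
  have h1 : (1 : V) ∈ M := Submodule.mem_sup_right (Submodule.mem_span_singleton_self 1)
  rw [← length_quotient_lsmul_eq_ord hfrac ha M hM h1]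
  have hker : LinearMap.range (LinearMap.lsmul R M a) ≤ LinearMap.ker (π.domRestrict M) := by
    rintro _ ⟨m, rfl⟩
    exact hπa m
  have hle : N ≤ LinearMap.range ((LinearMap.range (LinearMap.lsmul R M a)).liftQ _ hker) := by
    rw [Submodule.range_liftQ, LinearMap.range_domRestrict, ← hM₀N]
    exact Submodule.map_mono le_sup_left
  exact (Module.length_le_of_injective (Submodule.inclusion hle)
    (Submodule.inclusion_injective hle)).trans
    (Module.length_le_of_surjective _ (LinearMap.surjective_rangeRestrict _))

/-- A case of the Krull–Akizuki theorem. -/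
theorem isNoetherianRing_of_le_fractionField
    (hfrac : ∀ v : V, ∃ c : R, c ≠ 0 ∧ ∃ r : R, c • v = algebraMap R V r) :
    IsNoetherianRing V := by
  have hinj : Function.Injective (algebraMap R V) := FaithfulSMul.algebraMap_injective R V
  rw [isNoetherianRing_iff_ideal_fg]
  intro I
  by_cases hI : I = ⊥
  · subst hI; exact Submodule.fg_bot
  obtain ⟨x, hxI, hx0⟩ := Submodule.exists_mem_ne_zero_of_ne_bot hI
  -- a nonzero ideal contains a nonzero element of `R`
  obtain ⟨c, hc, r, hr⟩ := hfrac x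
  have hr0 : r ≠ 0 := by
    rintro rfl
    rw [map_zero, Algebra.smul_def] at hr
    exact mul_ne_zero ((map_ne_zero_iff _ hinj).2 hc) hx0 hr
  have hno := isNoetherian_quotient_span_algebraMap hfrac hr0
  have hno' : IsNoetherian V (V ⧸ Ideal.span {algebraMap R V r}) := isNoetherian_of_tower R hno
  refine Submodule.fg_of_fg_map_of_fg_inf_ker (Ideal.span {algebraMap R V r}).mkQ
    (IsNoetherian.noetherian _) ?_
  rw [Submodule.ker_mkQ, inf_eq_right.2]
  · exact Submodule.fg_span_singleton _
  · rw [Ideal.span_le, Set.singleton_subset_iff, ← hr, Algebra.smul_def]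
    exact I.mul_mem_left _ hxI

theorem finite_residueField [IsLocalRing V]
    (hfrac : ∀ v : V, ∃ c : R, c ≠ 0 ∧ ∃ r : R, c • v = algebraMap R V r)
    {a : R} (ha : a ≠ 0) (haV : algebraMap R V a ∈ maximalIdeal V) :
    Module.Finite R (ResidueField V) := by
  have hno := isNoetherian_quotient_span_algebraMap hfrac ha
  have hle : Ideal.span {algebraMap R V a} ≤ maximalIdeal V := by
    simpa [Ideal.span_le] using haV
  exact Module.Finite.of_surjective
    ((Submodule.factor hle).restrictScalars R : _ →ₗ[R] V ⧸ maximalIdeal V)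
    (Submodule.factor_surjective hle)

end

/-! ### Arcs through a closed point of an affine variety -/

/-- If some nonzero element lies in every nonzero prime of a Noetherian local domain, then the
dimension is at most one. By Krull's principal ideal theorem every element of the maximal ideal
lies in one of the finitely many primes that are minimal over `f`; conclude by prime avoidance. -/
theorem krullDimLE_one_of_forall_mem_prime {R : Type*} [CommRing R] [IsDomain R]
    [IsNoetherianRing R] [IsLocalRing R] {f : R}
    (hf0 : f ≠ 0) (hf : ∀ P : Ideal R, P.IsPrime → P ≠ ⊥ → f ∈ P) : Ring.KrullDimLE 1 R := by
  refine Ring.KrullDimLE.mk₁' fun P hP0 hP ↦ ?_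
  obtain ⟨p₀, hp₀, -⟩ := Ideal.exists_minimalPrimes_le (I := Ideal.span {f}) (J := P)
    (by simpa [Ideal.span_le] using hf P hP hP0)
  have hcover : ((maximalIdeal R : Ideal R) : Set R) ⊆
      ⋃ p ∈ (Ideal.span {f}).minimalPrimes, (p : Set R) := by
    intro x hx
    rw [Set.mem_iUnion₂]
    by_cases hx0 : x = 0
    · exact ⟨p₀, hp₀, by simp [hx0]⟩
    obtain ⟨p, hp, -⟩ := Ideal.exists_minimalPrimes_le (I := Ideal.span {x}) (J := maximalIdeal R)
      (by simpa [Ideal.span_le] using hx)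
    have hpp : p.IsPrime := hp.1.1
    have hxp : x ∈ p := hp.1.2 (Ideal.mem_span_singleton_self x)
    have hp0 : p ≠ ⊥ := by
      rintro rfl
      exact hx0 hxp
    obtain ⟨q, hq, hqp⟩ := Ideal.exists_minimalPrimes_le (I := Ideal.span {f}) (J := p)
      (by simpa [Ideal.span_le] using hf p hpp hp0)
    have hqq : q.IsPrime := hq.1.1
    have hheight := Ideal.height_le_one_of_isPrincipal_of_mem_minimalPrimes _ p hp
    obtain rfl | hlt := hqp.eq_or_lt
    · exact ⟨q, hq, hxp⟩
    · have hq0 : q.height + 1 ≤ 0 + 1 :=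
        (Ideal.height_add_one_le_of_lt_of_isPrime hlt).trans (by simpa using hheight)
      have hq0' : q = ⊥ := Ideal.height_eq_zero_iff_eq_bot.1
        (nonpos_iff_eq_zero.1 ((ENat.add_le_add_iff_right ENat.one_ne_top).1 hq0))
      exact absurd (hq.1.2 (Ideal.mem_span_singleton_self f)) (by simpa [hq0'] using hf0)
  obtain ⟨q, hq, hle⟩ := (Ideal.subset_union_prime_finite (f := id)
    (Ideal.finite_minimalPrimes_of_isNoetherianRing R _) ⊥ ⊥ fun i hi _ _ ↦ hi.1.1).1 hcover
  have : P = maximalIdeal R := by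
    refine le_antisymm (le_maximalIdeal hP.ne_top) ?_
    refine hle.trans (hq.2 ⟨hP, ?_⟩ ((le_maximalIdeal hP.ne_top).trans hle))
    simpa [Ideal.span_le] using hf P hP hP0
  rw [this]
  infer_instance

/-- A local extension with finite residue extension does not enlarge an algebraically closed
residue field. The residue field of a local `K`-algebra is `K` when each element is congruent to a
constant. -/
theorem exists_sub_mem_maximalIdeal_of_finite {K R V : Type*} [Field K] [IsAlgClosed K] [CommRing R]
    [IsLocalRing R] [Algebra K R] [CommRing V] [IsLocalRing V] [Algebra R V] [Algebra K V]
    [IsScalarTower K R V] [IsLocalHom (algebraMap R V)]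
    (hres : ∀ x : R, ∃ k : K, x - algebraMap K R k ∈ maximalIdeal R)
    [hfin : Module.Finite R (ResidueField V)] (x : V) :
    ∃ k : K, x - algebraMap K V k ∈ maximalIdeal V := by
  have hfinK : Module.Finite K (ResidueField V) := by
    obtain ⟨s, hs⟩ := hfin.fg_top
    refine ⟨s, eq_top_iff.2 fun z _ ↦ ?_⟩
    have hz : z ∈ Submodule.span R (s : Set (ResidueField V)) := hs ▸ Submodule.mem_top
    induction hz using Submodule.span_induction with
    | mem z hz => exact Submodule.subset_span hz
    | zero => exact Submodule.zero_mem _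
    | add a b _ _ ha hb => exact Submodule.add_mem _ (ha trivial) (hb trivial)
    | smul r a _ ha =>
      obtain ⟨k, hk⟩ := hres r
      have hr : r • a = k • a := by
        rw [← sub_eq_zero, ← IsScalarTower.algebraMap_smul R k a, ← sub_smul, Algebra.smul_def,
          IsScalarTower.algebraMap_apply R V (ResidueField V)]
        have : algebraMap V (ResidueField V) (algebraMap R V (r - algebraMap K R k)) = 0 := by
          refine (residue_eq_zero_iff _).2 ?_
          rw [mem_maximalIdeal, mem_nonunits_iff, isUnit_map_iff]
          exact hk
        rw [this, zero_mul]
      rw [hr]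
      exact Submodule.smul_mem _ _ (ha trivial)
  obtain ⟨k, hk⟩ := (IsAlgClosed.algebraMap_bijective_of_isIntegral
    (k := K) (K := ResidueField V)).2 (residue V x)
  refine ⟨k, ?_⟩
  rw [← residue_eq_zero_iff, map_sub, sub_eq_zero, ← hk]
  rfl

/-- A one-dimensional local domain with residue field `K` embeds into `K⟦X⟧`, through a valuation
ring that dominates it, which is discrete by Krull–Akizuki. -/
theorem exists_algHom_powerSeries_injective {K R : Type*} [Field K] [IsAlgClosed K] [CommRing R]
    [IsDomain R] [IsNoetherianRing R] [IsLocalRing R] [Ring.KrullDimLE 1 R] [Algebra K R]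
    (hres : ∀ x : R, ∃ k : K, x - algebraMap K R k ∈ maximalIdeal R) :
    ∃ φ : R →ₐ[K] K⟦X⟧, Function.Injective φ ∧
      ∀ x ∈ maximalIdeal R, PowerSeries.constantCoeff (φ x) = 0 := by
  -- in dimension zero the arc is constant
  by_cases hR : IsField R
  · have hm : maximalIdeal R = ⊥ := isField_iff_maximalIdeal_eq.1 hR
    have hbij : Function.Bijective (Algebra.ofId K R) := by
      refine ⟨(algebraMap K R).injective, fun x ↦ ?_⟩
      obtain ⟨k, hk⟩ := hres x
      rw [hm, Ideal.mem_bot, sub_eq_zero] at hk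
      exact ⟨k, hk.symm⟩
    refine ⟨(Algebra.ofId K K⟦X⟧).comp (AlgEquiv.ofBijective _ hbij).symm.toAlgHom, ?_, ?_⟩
    · exact (algebraMap K K⟦X⟧).injective.comp (AlgEquiv.injective _)
    · intro x hx
      rw [hm, Ideal.mem_bot] at hx
      simp [hx]
  · obtain ⟨A, hA, hloc⟩ := exists_factor_valuationRing (algebraMap R (FractionRing R))
    let _ : Algebra R A := ((algebraMap R (FractionRing R)).codRestrict A.toSubring hA).toAlgebra
    have hloc' : IsLocalHom (algebraMap R A) := hloc
    have hcoe : ∀ r : R, ((algebraMap R A r : A) : FractionRing R) = algebraMap R _ r :=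
      fun r ↦ rfl
    let _ : Algebra K A := ((algebraMap R A).comp (algebraMap K R)).toAlgebra
    have : IsScalarTower K R A := IsScalarTower.of_algebraMap_eq fun _ ↦ rfl
    have hinj : Function.Injective (algebraMap R A) := fun r r' h ↦
      IsFractionRing.injective R (FractionRing R) (by rw [← hcoe, ← hcoe, h])
    have : FaithfulSMul R A := (faithfulSMul_iff_algebraMap_injective R A).2 hinj
    have hfrac : ∀ v : A, ∃ c : R, c ≠ 0 ∧ ∃ r : R, c • v = algebraMap R A r := by
      intro v
      obtain ⟨r, c, hc, hv⟩ := IsFractionRing.div_surjective (A := R) (v : FractionRing R)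
      have hc0 : c ≠ 0 := nonZeroDivisors.ne_zero hc
      refine ⟨c, hc0, r, Subtype.ext ?_⟩
      have : algebraMap R (FractionRing R) c ≠ 0 :=
        (map_ne_zero_iff _ (IsFractionRing.injective R (FractionRing R))).2 hc0
      rw [Algebra.smul_def, hcoe]
      change (algebraMap R A c : FractionRing R) * v = _
      rw [hcoe, ← hv]
      field_simp
    have hno : IsNoetherianRing A := isNoetherianRing_of_le_fractionField hfrac
    obtain ⟨a, ham, ha0⟩ := Submodule.exists_mem_ne_zero_of_ne_bot
      (isField_iff_maximalIdeal_eq.not.1 hR)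
    have hle := ((local_hom_TFAE (algebraMap R A)).out 0 1).1 hloc'
    have haA : algebraMap R A a ∈ maximalIdeal A := hle ⟨a, ham, rfl⟩
    have hA0 : ¬ IsField A := by
      rw [isField_iff_maximalIdeal_eq]
      intro h
      rw [h, Ideal.mem_bot] at haA
      exact ha0 (hinj (by rw [haA, map_zero]))
    have hval : ValuationRing A := inferInstance
    have hdvr : IsDiscreteValuationRing A :=
      ((IsDiscreteValuationRing.TFAE A hA0).out 0 1).2 hval
    have hfin : Module.Finite R (ResidueField A) := finite_residueField hfrac ha0 haA
    obtain ⟨φ, hφ, hφ0⟩ := exists_algHom_powerSeries (K := K) (V := A)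
      (exists_sub_mem_maximalIdeal_of_finite (R := R) hres)
    exact ⟨φ.comp (IsScalarTower.toAlgHom K R A), hφ.comp hinj,
      fun x hx ↦ hφ0 _ (hle ⟨x, hx, rfl⟩)⟩

/-- A local domain with residue field `K` has a formal arc along which a given `f ≠ 0` does not
vanish. The quotient by a prime `q` that is maximal among those without `f` has dimension at most
one. -/
theorem exists_algHom_powerSeries_ne_zero {K R : Type*} [Field K] [IsAlgClosed K] [CommRing R]
    [IsDomain R] [IsNoetherianRing R] [IsLocalRing R] [Algebra K R]
    (hres : ∀ x : R, ∃ k : K, x - algebraMap K R k ∈ maximalIdeal R) {f : R} (hf : f ≠ 0) :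
    ∃ φ : R →ₐ[K] K⟦X⟧, φ f ≠ 0 ∧
      ∀ x ∈ maximalIdeal R, PowerSeries.constantCoeff (φ x) = 0 := by
  obtain ⟨q, ⟨hq, hfq⟩, hmax⟩ := set_has_maximal_iff_noetherian.2 ‹IsNoetherianRing R›
    {q : Ideal R | q.IsPrime ∧ f ∉ q} ⟨⊥, Ideal.isPrime_bot, hf⟩
  have hloc : IsLocalRing (R ⧸ q) :=
    .of_surjective' (Ideal.Quotient.mk q) Ideal.Quotient.mk_surjective
  have hlocHom : IsLocalHom (Ideal.Quotient.mk q) :=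
    .of_surjective _ Ideal.Quotient.mk_surjective
  have hmap : ∀ x ∈ maximalIdeal R, Ideal.Quotient.mk q x ∈ maximalIdeal (R ⧸ q) := fun x hx ↦ by
    rw [mem_maximalIdeal, mem_nonunits_iff, isUnit_map_iff]
    exact hx
  have : Ring.KrullDimLE 1 (R ⧸ q) := by
    refine krullDimLE_one_of_forall_mem_prime (f := Ideal.Quotient.mk q f)
      (mt Ideal.Quotient.eq_zero_iff_mem.1 hfq) fun P hP hP0 ↦ ?_
    by_contra hfP
    refine hmax (P.comap (Ideal.Quotient.mk q)) ⟨inferInstance, hfP⟩ ?_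
    refine lt_of_le_of_ne (fun x hx ↦ ?_) fun he ↦ hP0 ?_
    · rw [Ideal.mem_comap, Ideal.Quotient.eq_zero_iff_mem.2 hx]
      exact P.zero_mem
    · rw [eq_bot_iff]
      intro z hz
      obtain ⟨x, rfl⟩ := Ideal.Quotient.mk_surjective z
      rw [Ideal.mem_bot, Ideal.Quotient.eq_zero_iff_mem, he]
      exact hz
  obtain ⟨φ, hφ, hφ0⟩ := exists_algHom_powerSeries_injective (K := K) (R := R ⧸ q) fun z ↦ by
    obtain ⟨x, rfl⟩ := Ideal.Quotient.mk_surjective z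
    obtain ⟨k, hk⟩ := hres x
    exact ⟨k, by simpa using hmap _ hk⟩
  refine ⟨φ.comp (Ideal.Quotient.mkₐ K q), ?_, fun x hx ↦ hφ0 _ (hmap x hx)⟩
  exact (map_ne_zero_iff _ hφ).2 (mt Ideal.Quotient.eq_zero_iff_mem.1 hfq)

theorem exists_sub_mem_maximalIdeal_localization {K C : Type*} [Field K] [IsAlgClosed K]
    [CommRing C] [Algebra K C] [Algebra.FiniteType K C] (m : Ideal C) [m.IsMaximal]
    (x : Localization.AtPrime m) :
    ∃ k : K, x - algebraMap K (Localization.AtPrime m) k ∈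
      maximalIdeal (Localization.AtPrime m) := by
  let _ : Field (C ⧸ m) := Ideal.Quotient.field m
  have hfin : Module.Finite K (C ⧸ m) := finite_of_finite_type_of_isJacobsonRing K (C ⧸ m)
  obtain ⟨c, hc⟩ := m.algebraMap_residueField_surjective (residue _ x)
  obtain ⟨k, hk⟩ := (IsAlgClosed.algebraMap_bijective_of_isIntegral
    (k := K) (K := C ⧸ m)).2 (Ideal.Quotient.mk m c)
  refine ⟨k, ?_⟩
  have hck : algebraMap C m.ResidueField (c - algebraMap K C k) = 0 := by
    rw [Ideal.algebraMap_residueField_eq_zero, ← Ideal.Quotient.eq_zero_iff_mem, map_sub, ← hk]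
    exact sub_self _
  rw [map_sub, hc, sub_eq_zero, IsScalarTower.algebraMap_apply C (Localization.AtPrime m)
    m.ResidueField, ← IsScalarTower.algebraMap_apply K C (Localization.AtPrime m)] at hck
  rw [← residue_eq_zero_iff, map_sub, sub_eq_zero, hck]
  rfl

/-- Through every closed point of an affine variety passes a formal arc along which a given
nonzero function does not vanish. -/
theorem exists_algHom_powerSeries_of_isMaximal {K C : Type*} [Field K] [IsAlgClosed K]
    [CommRing C] [IsDomain C] [Algebra K C] [Algebra.FiniteType K C] (m : Ideal C) [m.IsMaximal]
    {f : C} (hf : f ≠ 0) :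
    ∃ φ : C →ₐ[K] K⟦X⟧, φ f ≠ 0 ∧ ∀ x ∈ m, PowerSeries.constantCoeff (φ x) = 0 := by
  have : IsNoetherianRing C := Algebra.FiniteType.isNoetherianRing K C
  have : IsNoetherianRing (Localization.AtPrime m) :=
    IsLocalization.isNoetherianRing m.primeCompl _ ‹_›
  have hinj : Function.Injective (algebraMap C (Localization.AtPrime m)) :=
    IsLocalization.injective _ m.primeCompl_le_nonZeroDivisors
  have : IsDomain (Localization.AtPrime m) :=
    IsLocalization.isDomain_localization m.primeCompl_le_nonZeroDivisors
  obtain ⟨φ, hφf, hφ⟩ := exists_algHom_powerSeries_ne_zero (K := K)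
    (exists_sub_mem_maximalIdeal_localization m) ((map_ne_zero_iff _ hinj).2 hf)
  refine ⟨φ.comp (IsScalarTower.toAlgHom K C _), hφf, fun x hx ↦ hφ _ ?_⟩
  exact (IsLocalization.AtPrime.to_map_mem_maximal_iff _ m x).2 hx

/-- The elements `a / s` of the field `L` with `a, s ∈ C` and `φ s ≠ 0`. -/
def nonvanishingLocalization {K L F : Type*} [Field K] [Field L] [Field F] [Algebra K L]
    (C : Subalgebra K L) (φ : C →+* F) : Subalgebra C L where
  carrier := {z | ∃ a s : C, φ s ≠ 0 ∧ z * s = a}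
  mul_mem' := by
    rintro z z' ⟨a, s, hs, h⟩ ⟨a', s', hs', h'⟩
    refine ⟨a * a', s * s', by simp [hs, hs'], ?_⟩
    push_cast
    linear_combination (z' * s') * h + a * h'
  add_mem' := by
    rintro z z' ⟨a, s, hs, h⟩ ⟨a', s', hs', h'⟩
    refine ⟨a * s' + a' * s, s * s', by simp [hs, hs'], ?_⟩
    push_cast
    linear_combination (s' : L) * h + s * h'
  algebraMap_mem' c := ⟨c, 1, by simp, mul_one _⟩

theorem mem_nonvanishingLocalization {K L F : Type*} [Field K] [Field L] [Field F] [Algebra K L]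
    {C : Subalgebra K L} {φ : C →+* F} {z : L} :
    z ∈ nonvanishingLocalization C φ ↔ ∃ a s : C, φ s ≠ 0 ∧ z * s = a := Iff.rfl

instance isLocalization_nonvanishingLocalization {K L F : Type*} [Field K] [Field L] [Field F]
    [Algebra K L] (C : Subalgebra K L) (φ : C →+* F) :
    IsLocalization ((nonZeroDivisors F).comap φ) (nonvanishingLocalization C φ) where
  map_units := by
    rintro ⟨s, hs⟩
    have hs0 : φ s ≠ 0 := nonZeroDivisors.ne_zero hs
    have hsL : (s : L) ≠ 0 := by
      intro h
      rw [show s = 0 from Subtype.ext h, map_zero] at hs0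
      exact hs0 rfl
    refine IsUnit.of_mul_eq_one ⟨(s : L)⁻¹, 1, s, hs0, inv_mul_cancel₀ hsL⟩ (Subtype.ext ?_)
    exact mul_inv_cancel₀ hsL
  surj := by
    rintro ⟨z, a, s, hs, h⟩
    exact ⟨(a, ⟨s, mem_nonZeroDivisors_of_ne_zero hs⟩), Subtype.ext h⟩
  exists_of_eq := by
    intro a b h
    have : (a : L) = b := congrArg (fun z : nonvanishingLocalization C φ ↦ (z : L)) h
    exact ⟨1, by rw [Subtype.ext this]⟩

/-- A ring homomorphism `φ : C → F` extends to the fractions with denominators `s`, `φ s ≠ 0`. -/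
theorem exists_ringHom_mul_eq {K L F B : Type*} [Field K] [Field L] [Field F] [Algebra K L]
    [CommRing B] (C : Subalgebra K L) (φ : C →+* F) (j : B →+* L)
    (hj : ∀ b, j b ∈ nonvanishingLocalization C φ) :
    ∃ Φ : B →+* F, ∀ (b : B) (a s : C), j b * s = a → Φ b * φ s = φ a := by
  let lift : nonvanishingLocalization C φ →+* F :=
    IsLocalization.lift (M := (nonZeroDivisors F).comap φ) (g := φ) fun s ↦
      (nonZeroDivisors.ne_zero s.2).isUnit
  have hlift : ∀ c, lift (algebraMap C _ c) = φ c := fun c ↦ IsLocalization.lift_eq _ c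
  refine ⟨lift.comp (j.codRestrict (nonvanishingLocalization C φ) hj), fun b a s h ↦ ?_⟩
  rw [← hlift s, ← hlift a, RingHom.comp_apply, ← RingHom.map_mul]
  exact congrArg lift (Subtype.ext h)

theorem algebraMap_laurentSeries_eq (K : Type*) [Field K] (k : K) :
    algebraMap K K⸨X⸩ k = algebraMap K⟦X⟧ K⸨X⸩ (algebraMap K K⟦X⟧ k) := rfl

/-- Lifting of arcs. Let `i : A → B` correspond to a morphism of affine varieties `Spec B → Spec
A`, and let `y` be a closed point of the closure of its image. Then some formal arc `Ψ` of `Spec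
A` through `y` lifts generically to an arc `Φ` of `Spec B`, and `Φ` can be taken outside the zeros
of a given `w ≠ 0`. -/
theorem exists_algHom_laurentSeries {K A B : Type*} [Field K] [IsAlgClosed K] [CommRing A]
    [CommRing B] [IsDomain B] [Algebra K A] [Algebra K B] [Algebra.FiniteType K A]
    [Algebra.FiniteType K B] (i : A →ₐ[K] B) (y : A →ₐ[K] K) (hy : ∀ a, i a = 0 → y a = 0)
    {w : B} (hw : w ≠ 0) :
    ∃ (Φ : B →ₐ[K] K⸨X⸩) (Ψ : A →ₐ[K] K⟦X⟧), (∀ a, Φ (i a) = algebraMap K⟦X⟧ K⸨X⸩ (Ψ a)) ∧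
      (∀ a, PowerSeries.constantCoeff (Ψ a) = y a) ∧ Φ w ≠ 0 := by
  classical
  set L := FractionRing B
  have hBL : Function.Injective (algebraMap B L) := IsFractionRing.injective B L
  let iL : A →ₐ[K] L := (IsScalarTower.toAlgHom K B L).comp i
  have hiL : ∀ a, iL a = 0 → y a = 0 := fun a ha ↦ hy a (hBL (by rw [map_zero]; exact ha))
  -- a valuation ring of `L` that dominates the image of `A` at the point `y`
  let I : Ideal iL.range.toSubring := (RingHom.ker y).map iL.rangeRestrict.toRingHom
  have hmemI : ∀ z, z ∈ I ↔ ∃ a, y a = 0 ∧ iL.rangeRestrict a = z := fun z ↦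
    Ideal.mem_map_iff_of_surjective _ iL.rangeRestrict_surjective
  have hI : I ≠ ⊤ := by
    rw [Ideal.ne_top_iff_one, hmemI]
    rintro ⟨a, ha, h⟩
    have h' : iL a = 1 := congrArg Subtype.val h
    have := hiL (a - 1) (by rw [map_sub, h', map_one, sub_self])
    rw [map_sub, ha, map_one] at this
    simp at this
  obtain ⟨V, hV, hIV⟩ := Ideal.image_subset_nonunits_valuationSubring I hI
  let V' : Subalgebra K L :=
    { V.toSubring with algebraMap_mem' := fun k ↦ hV (iL.range.algebraMap_mem k) }
  have hVV' : ∀ z, z ∈ V' ↔ z ∈ V := fun z ↦ Iff.rfl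
  have hrange : iL.range ≤ V' := hV
  -- `c` inverts an element when this is needed to bring it into `V`
  let c : L → L := fun z ↦ if z ∈ V then z else z⁻¹
  have hcV : ∀ z, c z ∈ V' := by
    intro z
    rw [hVV']
    by_cases hz : z ∈ V
    · simpa only [c, if_pos hz] using hz
    · simpa only [c, if_neg hz] using (V.mem_or_inv_mem z).resolve_left hz
  have hc0 : ∀ z, z ≠ 0 → c z ≠ 0 := by
    intro z hz
    simp only [c]
    split_ifs
    exacts [hz, inv_ne_zero hz]
  obtain ⟨S, hS⟩ := (Algebra.FiniteType.out : (⊤ : Subalgebra K B).FG)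
  let S' : Finset L := ((insert w S).image (algebraMap B L)).erase 0
  let C : Subalgebra K L := iL.range ⊔ Algebra.adjoin K (S'.image c : Finset L)
  have hCV : C ≤ V' := by
    refine sup_le hrange (Algebra.adjoin_le ?_)
    intro z hz
    obtain ⟨z, -, rfl⟩ := Finset.mem_image.1 hz
    exact hcV z
  have hcC : ∀ z ∈ S', c z ∈ C := fun z hz ↦
    (le_sup_right : _ ≤ C) (Algebra.subset_adjoin (Finset.mem_image_of_mem c hz))
  have hiC : ∀ a, iL a ∈ C := fun a ↦ (le_sup_left : _ ≤ C) ⟨a, rfl⟩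
  have hfg : C.FG := by
    refine Subalgebra.FG.sup ?_ ⟨_, rfl⟩
    rw [← Algebra.map_top]
    exact Algebra.FiniteType.out.map iL
  have hft : Algebra.FiniteType K C := C.fg_iff_finiteType.1 hfg
  -- a closed point of `C` over `y`
  let P : Ideal C := (maximalIdeal V).comap
    (Subring.inclusion (show C.toSubring ≤ V.toSubring from hCV))
  have hP : P ≠ ⊤ := Ideal.comap_ne_top _ (maximalIdeal.isMaximal V).ne_top
  obtain ⟨m, hm, hPm⟩ := P.exists_le_maximal hP
  -- an arc along which `f` does not vanish extends to the inverses of the elements `c z`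
  let f : C := ∏ z ∈ S'.attach, ⟨c z.1, hcC z.1 z.2⟩
  have hf : f ≠ 0 := Finset.prod_ne_zero_iff.2 fun z _ h ↦
    hc0 z.1 (Finset.mem_erase.1 z.2).1 (congrArg Subtype.val h)
  obtain ⟨φ, hφf, hφ⟩ := exists_algHom_powerSeries_of_isMaximal (K := K) m hf
  have hφc : ∀ z (hz : z ∈ S'), φ ⟨c z, hcC z hz⟩ ≠ 0 := by
    intro z hz
    rw [map_prod] at hφf
    exact Finset.prod_ne_zero_iff.1 hφf ⟨z, hz⟩ (Finset.mem_attach _ _)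
  let φL : C →+* K⸨X⸩ := (algebraMap K⟦X⟧ K⸨X⸩).comp φ.toRingHom
  have hφL : ∀ z (hz : z ∈ S'), φL ⟨c z, hcC z hz⟩ ≠ 0 := fun z hz ↦
    (map_ne_zero_iff _ (IsFractionRing.injective K⟦X⟧ K⸨X⸩)).2 (hφc z hz)
  have hS'mem : ∀ z ∈ S', z ∈ nonvanishingLocalization C φL := by
    intro z hz
    rw [mem_nonvanishingLocalization]
    by_cases hzV : z ∈ V
    · refine ⟨⟨c z, hcC z hz⟩, 1, by simp, ?_⟩
      simp [c, hzV]
    · refine ⟨1, ⟨c z, hcC z hz⟩, hφL z hz, ?_⟩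
      simpa [c, hzV] using mul_inv_cancel₀ (Finset.mem_erase.1 hz).1
  have hBmem : ∀ b : B, algebraMap B L b ∈ nonvanishingLocalization C φL := by
    intro b
    have hb : b ∈ Algebra.adjoin K (S : Set B) := hS ▸ Algebra.mem_top
    induction hb using Algebra.adjoin_induction with
    | mem b hb =>
      by_cases hb0 : algebraMap B L b = 0
      · rw [hb0]
        exact zero_mem _
      · exact hS'mem _ (Finset.mem_erase.2 ⟨hb0, Finset.mem_image_of_mem _
          (Finset.mem_insert_of_mem hb)⟩)
    | algebraMap k =>
      rw [← IsScalarTower.algebraMap_apply K B L]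
      exact (nonvanishingLocalization C φL).algebraMap_mem (algebraMap K C k)
    | add a b _ _ ha hb => rw [map_add]; exact add_mem ha hb
    | mul a b _ _ ha hb => rw [map_mul]; exact mul_mem ha hb
  obtain ⟨Φ, hΦ⟩ := exists_ringHom_mul_eq C φL (algebraMap B L) hBmem
  have hΦC : ∀ (b : B) (z : C), algebraMap B L b = z → Φ b = φL z := fun b z h ↦ by
    simpa using hΦ b z 1 (by simpa using h)
  refine ⟨{ Φ with commutes' := fun k ↦ ?_ }, φ.comp (iL.codRestrict C hiC), fun a ↦ ?_,
    fun a ↦ ?_, ?_⟩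
  · refine (hΦC _ (algebraMap K C k) (IsScalarTower.algebraMap_apply K B L k).symm).trans ?_
    change algebraMap K⟦X⟧ K⸨X⸩ (φ (algebraMap K C k)) = _
    rw [φ.commutes, algebraMap_laurentSeries_eq]
  · exact hΦC _ ⟨iL a, hiC a⟩ rfl
  · have hker : (iL.codRestrict C hiC (a - algebraMap K A (y a))) ∈ m := by
      refine hPm ?_
      have hmem : iL (a - algebraMap K A (y a)) ∈ V.nonunits :=
        hIV ⟨_, (hmemI _).2 ⟨a - algebraMap K A (y a), by simp, rfl⟩, rfl⟩
      obtain ⟨_, h⟩ := ValuationSubring.mem_nonunits_iff_exists_mem_maximalIdeal.1 hmem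
      exact h
    have h := hφ _ hker
    rw [map_sub, map_sub, map_sub, sub_eq_zero, AlgHom.commutes, AlgHom.commutes] at h
    exact h
  · change Φ w ≠ 0
    have hwS : algebraMap B L w ∈ S' := Finset.mem_erase.2 ⟨(map_ne_zero_iff _ hBL).2 hw,
      Finset.mem_image_of_mem _ (Finset.mem_insert_self _ _)⟩
    by_cases hwV : algebraMap B L w ∈ V
    · rw [hΦC w ⟨c (algebraMap B L w), hcC _ hwS⟩ (by simp [c, hwV])]
      exact hφL _ hwS
    · intro h0
      have h1 := hΦ w 1 ⟨c (algebraMap B L w), hcC _ hwS⟩ (by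
        simpa [c, hwV] using mul_inv_cancel₀ (Finset.mem_erase.1 hwS).1)
      rw [h0, zero_mul, map_one] at h1
      exact zero_ne_one h1

end LieDegeneration

noncomputable section

/-! ### Structure constants and the Zariski closure of an orbit -/

namespace LieDegeneration

variable {ι : Type*}

/-- The value at an algebra homomorphism of the generic matrix. -/
def genericMatrix {K A : Type*} [Field K] [CommRing A] [Algebra K A]
    (Φ : MvPolynomial (Option (ι × ι)) K →ₐ[K] A) :
    Matrix ι ι A := Matrix.of fun i j ↦ Φ (MvPolynomial.X (some (i, j)))

/-- The algebra homomorphism with prescribed scalar and matrix. -/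
def evalGeneric {K A : Type*} [Field K] [CommRing A] [Algebra K A] (P : Matrix ι ι A) (v : A) :
    MvPolynomial (Option (ι × ι)) K →ₐ[K] A :=
  MvPolynomial.aeval fun o ↦ o.elim v fun ij ↦ P ij.1 ij.2

theorem genericMatrix_evalGeneric {K A : Type*} [Field K] [CommRing A] [Algebra K A]
    (P : Matrix ι ι A) (v : A) : genericMatrix (evalGeneric (K := K) P v) = P := by
  ext i j
  simp [genericMatrix, evalGeneric]

theorem evalGeneric_X_none {K A : Type*} [Field K] [CommRing A] [Algebra K A]
    (P : Matrix ι ι A) (v : A) : evalGeneric (K := K) P v (MvPolynomial.X none) = v := by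
  simp [evalGeneric]

variable [Fintype ι]

/-- Transport of structure constants: if `P * Q = 1`, then `actConst P Q c` are the structure
constants, with respect to the basis formed by the columns of `P`, of the bilinear map with
structure constants `c`. -/
def actConst {F : Type*} [CommRing F] (P Q : Matrix ι ι F) (c : ι × ι × ι → F) : ι × ι × ι → F :=
  fun t ↦ ∑ a, ∑ b, ∑ d, P a t.1 * P b t.2.1 * c (a, b, d) * Q t.2.2 d

theorem map_actConst {F G : Type*} [CommRing F] [CommRing G] (f : F →+* G) (P Q : Matrix ι ι F)
    (c : ι × ι × ι → F) (t : ι × ι × ι) :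
    f (actConst P Q c t) = actConst (P.map f) (Q.map f) (f ∘ c) t := by
  simp [actConst]

theorem actConst_smul_smul {F : Type*} [CommRing F] (P Q : Matrix ι ι F) (c : ι × ι × ι → F)
    (r s : F) : actConst (r • P) (s • Q) c = (r ^ 2 * s) • actConst P Q c := by
  ext t
  simp only [actConst, Matrix.smul_apply, smul_eq_mul, Pi.smul_apply, Finset.mul_sum]
  refine Finset.sum_congr rfl fun _ _ ↦ Finset.sum_congr rfl fun _ _ ↦
    Finset.sum_congr rfl fun _ _ ↦ ?_
  ring

/-- The relation `φ(P eᵢ, P eⱼ) = P φ'(eᵢ, eⱼ)` in terms of structure constants, where `φ'` is the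
transported bilinear map. -/
theorem sum_actConst_mul [DecidableEq ι] {F : Type*} [CommRing F] {P Q : Matrix ι ι F}
    (hPQ : P * Q = 1)
    (c : ι × ι × ι → F) (i j d : ι) :
    ∑ k, actConst P Q c (i, j, k) * P d k = ∑ a, ∑ b, P a i * P b j * c (a, b, d) := by
  have hPQ' : ∀ e, ∑ k, P d k * Q k e = if d = e then 1 else 0 := fun e ↦ by
    rw [← Matrix.mul_apply, hPQ, Matrix.one_apply]
  simp only [actConst, Finset.sum_mul]
  rw [Finset.sum_comm]
  refine Finset.sum_congr rfl fun a _ ↦ ?_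
  rw [Finset.sum_comm]
  refine Finset.sum_congr rfl fun b _ ↦ ?_
  rw [Finset.sum_comm]
  calc ∑ e, ∑ k, P a i * P b j * c (a, b, e) * Q k e * P d k
      = ∑ e, P a i * P b j * c (a, b, e) * ∑ k, P d k * Q k e := by
        refine Finset.sum_congr rfl fun e _ ↦ ?_
        rw [Finset.mul_sum]
        exact Finset.sum_congr rfl fun k _ ↦ by ring
    _ = _ := by simp [hPQ']

theorem eq_actConst_of_sum_mul [DecidableEq ι] {F : Type*} [CommRing F] {P Q : Matrix ι ι F}
    (hQP : Q * P = 1)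
    {c c' : ι × ι × ι → F}
    (h : ∀ i j d, ∑ k, c' (i, j, k) * P d k = ∑ a, ∑ b, P a i * P b j * c (a, b, d)) :
    c' = actConst P Q c := by
  have hPQ : P * Q = 1 := mul_eq_one_comm.1 hQP
  funext ⟨i, j, k⟩
  have h1 : P.mulVec (fun k ↦ c' (i, j, k)) = P.mulVec fun k ↦ actConst P Q c (i, j, k) := by
    funext d
    simp only [Matrix.mulVec, dotProduct]
    simpa only [mul_comm] using (h i j d).trans (sum_actConst_mul hPQ c i j d).symm
  have h2 := congrArg Q.mulVec h1
  rw [Matrix.mulVec_mulVec, Matrix.mulVec_mulVec, hQP, Matrix.one_mulVec, Matrix.one_mulVec] at h2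
  exact congrFun h2 k

theorem actConst_eq_inv_det_smul [DecidableEq ι] {F : Type*} [Field F] {P Q : Matrix ι ι F}
    (hPQ : P * Q = 1) (c : ι × ι × ι → F) :
    actConst P Q c = (P.det)⁻¹ • actConst P P.adjugate c := by
  have hQ : Q = (P.det)⁻¹ • P.adjugate := by
    rw [← Matrix.inv_eq_right_inv hPQ, Matrix.inv_def, Ring.inverse_eq_inv']
  have := actConst_smul_smul P P.adjugate c 1 (P.det)⁻¹
  rwa [one_smul, ← hQ, one_pow, one_mul] at this

theorem exists_smul_actConst_adjugate_eq [DecidableEq ι] {F : Type*} [Field F] {P : Matrix ι ι F}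
    {v : F}
    (hP : P.det ≠ 0) (hv : v ≠ 0) (c : ι × ι × ι → F) :
    ∃ M N : Matrix ι ι F, M * N = 1 ∧ v • actConst P P.adjugate c = actConst M N c := by
  refine ⟨(v * P.det) • P, (v * P.det ^ 2)⁻¹ • P.adjugate, ?_, ?_⟩
  · rw [smul_mul_smul_comm, Matrix.mul_adjugate, smul_smul]
    convert one_smul F _
    field_simp
  · rw [actConst_smul_smul]
    congr 1
    field_simp

section

variable {K : Type*} [Field K] {V : Type*} [AddCommGroup V] [Module K V]

/-- The structure constants of a bilinear map with respect to a basis. -/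
def structConst (b : Module.Basis ι K V) (φ : Bilin K V) : ι × ι × ι → K :=
  fun t ↦ b.repr (φ (b t.1) (b t.2.1)) t.2.2

theorem apply_basis (b : Module.Basis ι K V) (φ : Bilin K V) (i j : ι) :
    φ (b i) (b j) = ∑ k, structConst b φ (i, j, k) • b k :=
  (b.sum_repr _).symm

/-- A structure constant as a linear functional on bilinear maps. -/
def structConstDual (b : Module.Basis ι K V) (t : ι × ι × ι) : Module.Dual K (Bilin K V) where
  toFun φ := structConst b φ t
  map_add' φ ψ := by simp [structConst]
  map_smul' r φ := by simp [structConst]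

/-- The bilinear map with a single nonzero structure constant, equal to `1`. -/
def elementaryBilin (b : Module.Basis ι K V) (t : ι × ι × ι) : Bilin K V :=
  (b.coord t.1).smulRight ((b.coord t.2.1).smulRight (b t.2.2))

theorem sum_structConst_smul (b : Module.Basis ι K V) (φ : Bilin K V) :
    ∑ t, structConst b φ t • elementaryBilin b t = φ := by
  classical
  refine b.ext fun i ↦ b.ext fun j ↦ ?_
  rw [apply_basis b φ]
  simp only [elementaryBilin, LinearMap.sum_apply, LinearMap.smul_apply,
    LinearMap.smulRight_apply, Module.Basis.coord_apply, Module.Basis.repr_self,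
    Fintype.sum_prod_type]
  simp [Finsupp.single_apply]

/-- The Zariski closure in terms of polynomials in the structure constants. -/
theorem mem_zariskiClosure_iff (b : Module.Basis ι K V) (S : Set (Bilin K V)) (y : Bilin K V) :
    y ∈ zariskiClosure K S ↔ ∀ q : MvPolynomial (ι × ι × ι) K,
      (∀ s ∈ S, MvPolynomial.eval (structConst b s) q = 0) →
        MvPolynomial.eval (structConst b y) q = 0 := by
  constructor
  · intro h q hq
    have := h (MvPolynomial.rename (structConstDual b) q) fun s hs ↦ by
      rw [MvPolynomial.eval_rename]
      exact hq s hs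
    rw [MvPolynomial.eval_rename] at this
    exact this
  · intro h p hp
    have key : ∀ s, MvPolynomial.eval (structConst b s) (MvPolynomial.bind₁ (fun l ↦
        ∑ t, MvPolynomial.C (l (elementaryBilin b t)) * MvPolynomial.X t) p) =
          MvPolynomial.eval (fun l ↦ l s) p := by
      intro s
      rw [← MvPolynomial.coe_aeval_eq_eval, ← MvPolynomial.coe_aeval_eq_eval]
      simp only [RingHom.coe_coe, MvPolynomial.aeval_bind₁]
      congr 2
      funext l
      have hl : l s = ∑ t, structConst b s t * l (elementaryBilin b t) := by
        conv_lhs => rw [← sum_structConst_smul b s]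
        simp only [map_sum, map_smul, smul_eq_mul]
      simp only [hl, map_sum, map_mul, MvPolynomial.aeval_X, MvPolynomial.aeval_C,
        Algebra.algebraMap_self, RingHom.id_apply]
      exact Finset.sum_congr rfl fun t _ ↦ mul_comm _ _
    rw [← key]
    exact h _ fun s hs ↦ (key s).trans (hp s hs)

theorem structConst_transport [DecidableEq ι] (b : Module.Basis ι K V) (g : V ≃ₗ[K] V)
    (φ : Bilin K V) :
    structConst b (transport g φ) =
      actConst (LinearMap.toMatrix b b g.symm) (LinearMap.toMatrix b b g) (structConst b φ) := by
  refine eq_actConst_of_sum_mul ?_ fun i j d ↦ ?_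
  · rw [← LinearMap.toMatrix_comp, LinearEquiv.comp_symm, LinearMap.toMatrix_id]
  have hg : ∀ i, g.symm (b i) = ∑ a, LinearMap.toMatrix b b g.symm a i • b a := fun i ↦ by
    simp only [LinearMap.toMatrix_apply, LinearEquiv.coe_coe, b.sum_repr]
  have h1 : g.symm (transport g φ (b i) (b j)) = φ (g.symm (b i)) (g.symm (b j)) := by
    rw [transport_apply, LinearEquiv.symm_apply_apply]
  rw [apply_basis b (transport g φ), map_sum] at h1
  have h2 := congrArg (fun z ↦ b.repr z d) h1
  rw [hg i, hg j] at h2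
  simp only [map_sum, map_smul, LinearMap.sum_apply, LinearMap.smul_apply, Finsupp.coe_finsetSum,
    Finset.sum_apply, Finsupp.smul_apply, smul_eq_mul] at h2
  simp only [LinearMap.toMatrix_apply, LinearEquiv.coe_coe] at h2 ⊢
  rw [h2]
  simp only [Finset.mul_sum]
  rw [Finset.sum_comm]
  refine Finset.sum_congr rfl fun a _ ↦ Finset.sum_congr rfl fun e _ ↦ ?_
  simp only [structConst]
  ring

theorem exists_mem_orbit_of_mul_eq_one [DecidableEq ι] (b : Module.Basis ι K V) (φ : Bilin K V)
    {P Q : Matrix ι ι K} (hPQ : P * Q = 1) :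
    ∃ ψ ∈ orbit φ, structConst b ψ = actConst P Q (structConst b φ) := by
  let g : V ≃ₗ[K] V := LinearEquiv.ofLinearMap (Matrix.toLin b b Q) (Matrix.toLin b b P)
    (by rw [← Matrix.toLin_mul, mul_eq_one_comm.1 hPQ, Matrix.toLin_one])
    (by rw [← Matrix.toLin_mul, hPQ, Matrix.toLin_one])
  refine ⟨transport g φ, ⟨g, rfl⟩, ?_⟩
  rw [structConst_transport]
  congr 1
  · exact LinearMap.toMatrix_toLin b b P
  · exact LinearMap.toMatrix_toLin b b Q

/-- The structure constants of the generic point `v • (P, adj P)` of the orbit, where `v` and the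
entries of `P` are indeterminates. As `adj P = det P • P⁻¹`, it specializes to points of the
orbit wherever `v` and `det P` do not vanish. -/
def genericConst [DecidableEq ι] (c : ι × ι × ι → K) : ι × ι × ι → MvPolynomial
    (Option (ι × ι)) K :=
  (MvPolynomial.X none : MvPolynomial (Option (ι × ι)) K) •
    actConst (Matrix.of fun i j ↦ MvPolynomial.X (some (i, j)))
      (Matrix.of fun i j ↦ MvPolynomial.X (some (i, j))).adjugate (MvPolynomial.C ∘ c)

theorem map_aeval_genericConst [DecidableEq ι] {A : Type*} [CommRing A] [Algebra K A]
    (Φ : MvPolynomial (Option (ι × ι)) K →ₐ[K] A) (c : ι × ι × ι → K)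
    (q : MvPolynomial (ι × ι × ι) K) :
    Φ (MvPolynomial.aeval (genericConst c) q) =
      MvPolynomial.aeval (Φ (MvPolynomial.X none) •
        actConst (genericMatrix Φ) (genericMatrix Φ).adjugate (algebraMap K A ∘ c)) q := by
  rw [MvPolynomial.comp_aeval_apply]
  congr 2
  funext t
  rw [genericConst, Pi.smul_apply, smul_eq_mul, map_mul, Pi.smul_apply, smul_eq_mul]
  congr 1
  have h := map_actConst Φ.toRingHom (Matrix.of fun i j ↦ MvPolynomial.X (some (i, j)))
      (Matrix.of fun i j ↦ MvPolynomial.X (some (i, j))).adjugate (MvPolynomial.C ∘ c) t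
  have h1 : (Matrix.of fun i j ↦ MvPolynomial.X (R := K) (some (i, j))).map Φ.toRingHom =
      genericMatrix Φ := rfl
  have h2 := Φ.toRingHom.map_adjugate (Matrix.of fun i j ↦ MvPolynomial.X (some (i, j)))
  rw [RingHom.mapMatrix_apply, RingHom.mapMatrix_apply, h1] at h2
  rw [h1, h2] at h
  refine h.trans ?_
  congr 1
  funext t
  exact Φ.commutes (c t)

theorem det_genericMatrix [DecidableEq ι] {A : Type*} [CommRing A] [Algebra K A]
    (Φ : MvPolynomial (Option (ι × ι)) K →ₐ[K] A) :
    (genericMatrix Φ).det = Φ (Matrix.of fun i j ↦ MvPolynomial.X (some (i, j))).det :=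
  (Φ.toRingHom.map_det _).symm

theorem X_none_mul_det_ne_zero [DecidableEq ι] :
    (MvPolynomial.X none * (Matrix.of fun i j : ι ↦ MvPolynomial.X (some (i, j))).det :
      MvPolynomial (Option (ι × ι)) K) ≠ 0 := by
  intro h
  have := congrArg (evalGeneric (1 : Matrix ι ι K) 1) h
  rw [map_mul, ← det_genericMatrix, genericMatrix_evalGeneric, evalGeneric_X_none] at this
  simp at this

/-- A polynomial vanishes on an orbit if and only if it vanishes at the generic point: its value
there, multiplied by `v * det P`, is a polynomial that vanishes identically on an infinite field.
-/
theorem aeval_genericConst_eq_zero_iff [DecidableEq ι] [Infinite K] (b : Module.Basis ι K V)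
    (φ : Bilin K V) (q : MvPolynomial (ι × ι × ι) K) :
    MvPolynomial.aeval (genericConst (structConst b φ)) q = 0 ↔
      ∀ s ∈ orbit φ, MvPolynomial.eval (structConst b s) q = 0 := by
  constructor
  · rintro h _ ⟨g, rfl⟩
    have hPQ : LinearMap.toMatrix b b g.symm * LinearMap.toMatrix b b g = 1 := by
      rw [← LinearMap.toMatrix_comp, LinearEquiv.symm_comp, LinearMap.toMatrix_id]
    rw [structConst_transport, actConst_eq_inv_det_smul hPQ]
    set P := LinearMap.toMatrix b b (g.symm : V →ₗ[K] V)
    have := map_aeval_genericConst (evalGeneric P P.det⁻¹) (structConst b φ) q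
    rw [h, map_zero, genericMatrix_evalGeneric, evalGeneric_X_none] at this
    exact this.symm
  · intro h
    -- the factor `v * det P` makes the vanishing hold at every point `z`
    refine (mul_eq_zero.1 ?_).resolve_right (X_none_mul_det_ne_zero (K := K) (ι := ι))
    refine MvPolynomial.funext fun z ↦ ?_
    let Φ : MvPolynomial (Option (ι × ι)) K →ₐ[K] K := MvPolynomial.aeval z
    change Φ _ = Φ 0
    rw [map_mul, map_mul, ← det_genericMatrix, map_zero]
    by_cases hv : Φ (MvPolynomial.X none) = 0
    · rw [hv, zero_mul, mul_zero]
    by_cases hP : (genericMatrix Φ).det = 0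
    · rw [hP, mul_zero, mul_zero]
    obtain ⟨M, N, hMN, hc⟩ := exists_smul_actConst_adjugate_eq hP hv (structConst b φ)
    obtain ⟨ψ, hψ, hψc⟩ := exists_mem_orbit_of_mul_eq_one b φ hMN
    have h0 := h ψ hψ
    rw [hψc, ← hc] at h0
    rw [map_aeval_genericConst]
    exact mul_eq_zero_of_left h0 _

/-- The curve criterion for membership in an orbit closure: `y` is the value at `0` of a
`K⟦X⟧`-point that lies in the orbit over `K⸨X⸩`. -/
theorem mem_zariskiClosure_orbit_iff [IsAlgClosed K] [DecidableEq ι] (b : Module.Basis ι K V)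
    (φ y : Bilin K V) :
    y ∈ zariskiClosure K (orbit φ) ↔
      ∃ (c : ι × ι × ι → K⟦X⟧) (M N : Matrix ι ι K⸨X⸩), M * N = 1 ∧
        (algebraMap K⟦X⟧ K⸨X⸩ ∘ c = actConst M N (algebraMap K K⸨X⸩ ∘ structConst b φ)) ∧
        ∀ t, PowerSeries.constantCoeff (c t) = structConst b y t := by
  have : Infinite K := IsAlgClosed.instInfinite
  rw [mem_zariskiClosure_iff b]
  constructor
  · intro h
    obtain ⟨Φ, Ψ, hΦΨ, hΨ, hw⟩ := exists_algHom_laurentSeries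
      (MvPolynomial.aeval (R := K) (genericConst (structConst b φ)))
      (MvPolynomial.aeval (structConst b y))
      (fun q hq ↦ h q ((aeval_genericConst_eq_zero_iff b φ q).1 hq))
      (X_none_mul_det_ne_zero (K := K) (ι := ι))
    rw [map_mul, ← det_genericMatrix] at hw
    obtain ⟨M, N, hMN, hc⟩ := exists_smul_actConst_adjugate_eq (right_ne_zero_of_mul hw)
      (left_ne_zero_of_mul hw) (algebraMap K K⸨X⸩ ∘ structConst b φ)
    refine ⟨fun t ↦ Ψ (MvPolynomial.X t), M, N, hMN, ?_, fun t ↦ ?_⟩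
    · rw [← hc]
      funext t
      rw [Function.comp_apply, ← hΦΨ, map_aeval_genericConst, MvPolynomial.aeval_X]
    · rw [hΨ, MvPolynomial.aeval_X]
  · rintro ⟨c, M, N, hMN, hc, hy⟩ q hq
    rw [← aeval_genericConst_eq_zero_iff] at hq
    have h0 := map_aeval_genericConst (evalGeneric M M.det⁻¹) (structConst b φ) q
    rw [hq, map_zero, genericMatrix_evalGeneric, evalGeneric_X_none,
      ← actConst_eq_inv_det_smul hMN, ← hc] at h0
    let toLaurent : K⟦X⟧ →ₐ[K] K⸨X⸩ :=
      { algebraMap K⟦X⟧ K⸨X⸩ with commutes' := fun k ↦ (algebraMap_laurentSeries_eq K k).symm }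
    have h1 : MvPolynomial.aeval c q = 0 := by
      refine IsFractionRing.injective K⟦X⟧ K⸨X⸩ ?_
      rw [map_zero, h0]
      exact MvPolynomial.comp_aeval_apply (f := c) toLaurent q
    let specialize : K⟦X⟧ →ₐ[K] K :=
      { PowerSeries.constantCoeff with commutes' := fun k ↦ PowerSeries.constantCoeff_C k }
    have h2 := congrArg specialize h1
    rw [MvPolynomial.comp_aeval_apply, map_zero] at h2
    rw [← h2, ← MvPolynomial.coe_aeval_eq_eval, ← funext hy]
    rfl

end

end LieDegeneration

end

noncomputable section

/-! ### Structure constants of Lie algebras -/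

namespace LieDegeneration

attribute [local instance] specializationAlgebra

/-- The family `w` of elements of a Lie algebra has structure constants `c`. -/
def HasStructConst {ι R L : Type*} [Fintype ι] [CommRing R] [LieRing L] [LieAlgebra R L]
    (w : ι → L) (c : ι × ι × ι → R) : Prop :=
  ∀ i j, ⁅w i, w j⁆ = ∑ k, c (i, j, k) • w k

namespace HasStructConst

variable {ι : Type*} [Fintype ι]

section

variable {R L : Type*} [CommRing R] [LieRing L] [LieAlgebra R L] {w : ι → L} {c : ι × ι × ι → R}

theorem lie_sum_smul (h : HasStructConst w c) (x y : ι → R) :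
    ⁅∑ i, x i • w i, ∑ j, y j • w j⁆ = ∑ k, (∑ i, ∑ j, x i * y j * c (i, j, k)) • w k := by
  have h' : ∀ i j, ⁅w i, w j⁆ = ∑ k, c (i, j, k) • w k := h
  calc ⁅∑ i, x i • w i, ∑ j, y j • w j⁆ = ∑ i, ∑ j, ∑ k, (x i * y j * c (i, j, k)) • w k := by
        simp only [sum_lie, lie_sum, smul_lie, lie_smul, h', Finset.smul_sum, smul_smul]
        rw [Finset.sum_comm]
        simp only [mul_assoc, mul_left_comm]
    _ = ∑ i, ∑ k, ∑ j, (x i * y j * c (i, j, k)) • w k :=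
        Finset.sum_congr rfl fun _ _ ↦ Finset.sum_comm
    _ = ∑ k, ∑ i, ∑ j, (x i * y j * c (i, j, k)) • w k := Finset.sum_comm
    _ = _ := by simp only [Finset.sum_smul]

theorem ext_const (h : HasStructConst w c) {c' : ι × ι × ι → R} (h' : HasStructConst w c')
    (hw : LinearIndependent R w) : c = c' := by
  funext ⟨i, j, k⟩
  have h1 := (h i j).symm.trans (h' i j)
  rw [← sub_eq_zero, ← Finset.sum_sub_distrib] at h1
  simp only [← sub_smul] at h1
  exact sub_eq_zero.1 (Fintype.linearIndependent_iff.1 hw _ h1 k)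

theorem exists_basis_actConst [DecidableEq ι] {β : Module.Basis ι R L} (h : HasStructConst β c)
    {M N : Matrix ι ι R} (hMN : M * N = 1) :
    ∃ w : Module.Basis ι R L, HasStructConst w (actConst M N c) := by
  let g : L ≃ₗ[R] L := LinearEquiv.ofLinearMap (Matrix.toLin β β M) (Matrix.toLin β β N)
    (by rw [← Matrix.toLin_mul, hMN, Matrix.toLin_one])
    (by rw [← Matrix.toLin_mul, mul_eq_one_comm.1 hMN, Matrix.toLin_one])
  have hg : ∀ k, β.map g k = ∑ d, M d k • β d := fun k ↦ by
    rw [Module.Basis.map_apply]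
    exact Matrix.toLin_self β β M k
  refine ⟨β.map g, fun i j ↦ ?_⟩
  simp only [hg]
  rw [h.lie_sum_smul]
  simp only [← sum_actConst_mul hMN, Finset.smul_sum, smul_smul, Finset.sum_smul]
  exact Finset.sum_comm

theorem eq_actConst [DecidableEq ι] {β w : Module.Basis ι R L} (h : HasStructConst β c)
    {c' : ι × ι × ι → R} (h' : HasStructConst w c') :
    c' = actConst (β.toMatrix w) (w.toMatrix β) c := by
  refine eq_actConst_of_sum_mul (w.toMatrix_mul_toMatrix_flip β) fun i j d ↦ ?_
  have hw : ∀ k, w k = ∑ d, β.toMatrix w d k • β d := fun k ↦ (β.sum_toMatrix_smul_self w k).symm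
  have h1 := h' i j
  rw [hw i, hw j, h.lie_sum_smul] at h1
  have h2 := congrArg (fun z ↦ β.repr z d) h1
  simp only [map_sum, map_smul, Finsupp.coe_finsetSum, Finset.sum_apply, Finsupp.smul_apply,
    smul_eq_mul, Module.Basis.repr_self] at h2
  simp [Finsupp.single_apply] at h2
  rw [h2]
  rfl

theorem baseChange (h : HasStructConst w c) (A : Type*) [CommRing A] [Algebra R A] :
    HasStructConst (R := A) (L := ScalarExtension R A L) (fun i ↦ (1 : A) ⊗ₜ[R] w i)
      (algebraMap R A ∘ c) := by
  intro i j
  rw [LieAlgebra.ExtendScalars.bracket_tmul, h i j, TensorProduct.tmul_sum, mul_one]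
  refine Finset.sum_congr rfl fun k _ ↦ ?_
  rw [TensorProduct.tmul_smul, Function.comp_apply, algebraMap_smul]

theorem map {L' : Type*} [LieRing L'] [LieAlgebra R L'] (h : HasStructConst w c)
    (e : L →ₗ⁅R⁆ L') : HasStructConst (e ∘ w) c := by
  intro i j
  simp only [Function.comp_apply]
  rw [← LieHom.map_lie, h i j, map_sum]
  simp

/-- Two Lie algebras that have bases with the same structure constants are isomorphic. -/
theorem nonempty_lieEquiv {L' : Type*} [LieRing L'] [LieAlgebra R L'] {w : Module.Basis ι R L}
    {w' : Module.Basis ι R L'} (h : HasStructConst w c) (h' : HasStructConst w' c) :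
    Nonempty (L ≃ₗ⁅R⁆ L') := by
  let e : L ≃ₗ[R] L' := w.equiv w' (Equiv.refl ι)
  have he : ∀ i, e (w i) = w' i := fun i ↦ by simp [e]
  refine ⟨{ e with map_lie' := fun {x y} ↦ ?_ }⟩
  change e ⁅x, y⁆ = ⁅e x, e y⁆
  rw [← w.sum_repr x, ← w.sum_repr y, h.lie_sum_smul]
  simp only [map_sum, map_smul, he]
  rw [h'.lie_sum_smul]

end

end HasStructConst

theorem hasStructConst_point {ι K L V : Type*} [Fintype ι] [Field K] [LieRing L] [LieAlgebra K L]
    [AddCommGroup V] [Module K V] (b : Module.Basis ι K V) (e : L ≃ₗ[K] V) :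
    HasStructConst (b.map e.symm) (structConst b (point e)) := by
  intro i j
  apply e.injective
  simp only [Module.Basis.map_apply, map_sum, map_smul, LinearEquiv.apply_symm_apply]
  rw [← apply_basis, point_apply]

theorem isAdicComplete_span_singleton_pi {ι R : Type*} [CommRing R] (a : R)
    [IsAdicComplete (Ideal.span {a}) R] : IsAdicComplete (Ideal.span {a}) (ι → R) := by
  have hmem : ∀ (n : ℕ) (x : ι → R), x ∈ (Ideal.span {a} ^ n • ⊤ : Submodule R (ι → R)) ↔
      ∀ i, x i ∈ (Ideal.span {a} ^ n • ⊤ : Submodule R R) := by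
    intro n x
    simp only [Ideal.span_singleton_pow, Submodule.ideal_span_singleton_smul,
      Submodule.mem_smul_pointwise_iff_exists, Submodule.mem_top, true_and]
    constructor
    · rintro ⟨y, rfl⟩ i
      exact ⟨y i, rfl⟩
    · intro h
      choose y hy using h
      exact ⟨y, funext hy⟩
  have hmod : ∀ (n : ℕ) (x y : ι → R), x ≡ y [SMOD (Ideal.span {a} ^ n • ⊤ : Submodule R (ι → R))] ↔
      ∀ i, x i ≡ y i [SMOD (Ideal.span {a} ^ n • ⊤ : Submodule R R)] := by
    intro n x y
    simp only [SModEq.sub_mem]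
    exact hmem n (x - y)
  refine { haus' := fun x hx ↦ ?_, prec' := fun f hf ↦ ?_ }
  · exact funext fun i ↦ IsHausdorff.haus (I := Ideal.span {a}) inferInstance (x i)
      fun n ↦ (hmod n x 0).1 (hx n) i
  · choose L hL using fun i ↦ IsPrecomplete.prec (I := Ideal.span {a}) (M := R) inferInstance
      (f := fun n ↦ f n i) fun h ↦ (hmod _ _ _).1 (hf h) i
    exact ⟨L, fun n ↦ (hmod _ _ _).2 fun i ↦ hL i n⟩

end LieDegeneration

end

noncomputable section

/-! ### Lattices over `K⟦X⟧` -/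

namespace LieDegeneration

attribute [local instance] specializationAlgebra

section

variable {K E ι : Type*} [Fintype ι] [Field K] [AddCommGroup E] [Module K⟦X⟧ E] {v : ι → E}

theorem smul_tmul_specialization (a : K⟦X⟧) (x : E) :
    (1 : K) ⊗ₜ[K⟦X⟧] (a • x) = PowerSeries.constantCoeff a • ((1 : K) ⊗ₜ[K⟦X⟧] x) := by
  rw [TensorProduct.tmul_smul, ← algebraMap_smul K a]
  rfl

theorem X_dvd_of_sum_smul_eq (hv : LinearIndependent K fun i ↦ (1 : K) ⊗ₜ[K⟦X⟧] v i)
    {a : ι → K⟦X⟧} {z : E} (h : ∑ i, a i • v i = (PowerSeries.X : K⟦X⟧) • z) (i : ι) :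
    (PowerSeries.X : K⟦X⟧) ∣ a i := by
  rw [PowerSeries.X_dvd_iff]
  have h1 := congrArg (fun z ↦ (1 : K) ⊗ₜ[K⟦X⟧] z) h
  simp only [TensorProduct.tmul_sum, smul_tmul_specialization, PowerSeries.constantCoeff_X,
    zero_smul] at h1
  exact Fintype.linearIndependent_iff.1 hv _ h1 i

variable [Module.IsTorsionFree K⟦X⟧ E]

/-- Lifts of linearly independent elements of the special fibre are linearly independent. -/
theorem linearIndependent_of_specialization
    (hv : LinearIndependent K fun i ↦ (1 : K) ⊗ₜ[K⟦X⟧] v i) : LinearIndependent K⟦X⟧ v := by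
  rw [Fintype.linearIndependent_iff]
  have key : ∀ (m : ℕ) (a : ι → K⟦X⟧), ∑ i, a i • v i = 0 →
      ∀ i, (PowerSeries.X : K⟦X⟧) ^ m ∣ a i := by
    intro m
    induction m with
    | zero => simp
    | succ m ih =>
      intro a ha i
      choose a' ha' using X_dvd_of_sum_smul_eq (z := 0) hv (by rw [ha, smul_zero])
      have h0 : (PowerSeries.X : K⟦X⟧) • ∑ i, a' i • v i = 0 := by
        rw [← ha, Finset.smul_sum]
        exact Finset.sum_congr rfl fun i _ ↦ by rw [smul_smul, ← ha']
      rw [ha', pow_succ']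
      exact mul_dvd_mul_left _ (ih a' ((smul_eq_zero.1 h0).resolve_left PowerSeries.X_ne_zero) i)
  intro a ha i
  ext n
  exact PowerSeries.X_pow_dvd_iff.1 (key (n + 1) a ha i) n n.lt_succ_self

variable (F : Type*) [Field F] [Algebra K⟦X⟧ F] [IsFractionRing K⟦X⟧ F]

theorem tmul_fractionField_injective :
    Function.Injective fun x : E ↦ (1 : F) ⊗ₜ[K⟦X⟧] x := by
  intro x y h
  obtain ⟨c, hc⟩ := (IsLocalizedModule.eq_iff_exists (nonZeroDivisors K⟦X⟧)
    (TensorProduct.mk K⟦X⟧ F E 1)).1 h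
  exact smul_right_injective E (nonZeroDivisors.ne_zero c.2) hc

theorem linearIndependent_fractionField
    (hv : LinearIndependent K fun i ↦ (1 : K) ⊗ₜ[K⟦X⟧] v i) :
    LinearIndependent F fun i ↦ (1 : F) ⊗ₜ[K⟦X⟧] v i :=
  (linearIndependent_of_specialization hv).of_isLocalizedModule F (nonZeroDivisors K⟦X⟧)
    (TensorProduct.mk K⟦X⟧ F E 1)

/-- Lifts of linearly independent elements of the special fibre generate a torsion-free module if
their number is the generic rank: they generate it generically, and their span is saturated with
respect to `X`. -/
theorem span_eq_top_of_specialization [FiniteDimensional F (F ⊗[K⟦X⟧] E)]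
    (hv : LinearIndependent K fun i ↦ (1 : K) ⊗ₜ[K⟦X⟧] v i)
    (hrank : Module.finrank F (F ⊗[K⟦X⟧] E) = Fintype.card ι) :
    Submodule.span K⟦X⟧ (Set.range v) = ⊤ := by
  classical
  -- the span is saturated: an element of it divisible by `X` has coefficients divisible by `X`
  have hX : ∀ (n : ℕ) (z : E), (PowerSeries.X : K⟦X⟧) ^ n • z ∈ Submodule.span K⟦X⟧ (Set.range v) →
      z ∈ Submodule.span K⟦X⟧ (Set.range v) := by
    intro n
    induction n with
    | zero => simp
    | succ n ih =>
      intro z hz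
      rw [pow_succ', mul_smul] at hz
      refine ih z ?_
      obtain ⟨a, ha⟩ := (Submodule.mem_span_range_iff_exists_fun _).1 hz
      choose a' ha' using X_dvd_of_sum_smul_eq hv ha
      refine (Submodule.mem_span_range_iff_exists_fun _).2 ⟨a', ?_⟩
      refine smul_right_injective E (PowerSeries.X_ne_zero (R := K)) ?_
      change (PowerSeries.X : K⟦X⟧) • _ = (PowerSeries.X : K⟦X⟧) • _
      rw [← ha, Finset.smul_sum]
      exact Finset.sum_congr rfl fun i _ ↦ by rw [smul_smul, ← ha']
  rw [eq_top_iff]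
  rintro z -
  have hspan := (linearIndependent_fractionField F hv).span_eq_top_of_card_eq_finrank' hrank.symm
  have hz : (1 : F) ⊗ₜ[K⟦X⟧] z ∈ Submodule.span F
      (Set.range fun i ↦ (1 : F) ⊗ₜ[K⟦X⟧] v i) := hspan ▸ Submodule.mem_top
  obtain ⟨r, hr⟩ := (Submodule.mem_span_range_iff_exists_fun _).1 hz
  obtain ⟨s, hs⟩ := IsLocalization.exist_integer_multiples_of_finite (nonZeroDivisors K⟦X⟧) r
  choose a ha using hs
  have hsz : (s : K⟦X⟧) • z = ∑ i, a i • v i := by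
    refine tmul_fractionField_injective (K := K) F ?_
    simp only [TensorProduct.tmul_smul, TensorProduct.tmul_sum]
    rw [← hr, Finset.smul_sum]
    refine Finset.sum_congr rfl fun i _ ↦ ?_
    rw [← algebraMap_smul F (a i), ha, smul_assoc]
  obtain ⟨n, u, hn⟩ := IsDiscreteValuationRing.associated_pow_irreducible
    (nonZeroDivisors.ne_zero s.2) (PowerSeries.X_irreducible (R := K))
  refine hX n z ?_
  rw [← hn, mul_comm, mul_smul, hsz]
  exact Submodule.smul_mem _ _ (Submodule.sum_mem _ fun i _ ↦
    Submodule.smul_mem _ _ (Submodule.subset_span ⟨i, rfl⟩))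

end

/-- A formal deformation of `𝔥` that is generically isomorphic to `𝔤` provides a curve of
structure constants that lies in the orbit of `𝔤` over `K⸨X⸩` and has value `𝔥` at `0`. -/
theorem exists_curve_of_formalDeformation {ι K V 𝔤 𝔥 E : Type*} [Fintype ι] [DecidableEq ι]
    [Field K] [AddCommGroup V] [Module K V] [LieRing 𝔤] [LieAlgebra K 𝔤] [LieRing 𝔥]
    [LieAlgebra K 𝔥]
    [LieRing E] [LieAlgebra K⟦X⟧ E] [Module.IsTorsionFree K⟦X⟧ E]
    (b : Module.Basis ι K V) (e : 𝔤 ≃ₗ[K] V) (f : 𝔥 ≃ₗ[K] V)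
    (σ : ScalarExtension K⟦X⟧ K E ≃ₗ⁅K⁆ 𝔥)
    (τ : ScalarExtension K⟦X⟧ K⸨X⸩ E ≃ₗ⁅K⸨X⸩⁆ ScalarExtension K K⸨X⸩ 𝔤) :
    ∃ (c : ι × ι × ι → K⟦X⟧) (M N : Matrix ι ι K⸨X⸩), M * N = 1 ∧
      (algebraMap K⟦X⟧ K⸨X⸩ ∘ c = actConst M N (algebraMap K K⸨X⸩ ∘ structConst b (point e))) ∧
      ∀ t, PowerSeries.constantCoeff (c t) = structConst b (point f) t := by
  let βh : Module.Basis ι K 𝔥 := b.map f.symm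
  let βg : Module.Basis ι K⸨X⸩ (ScalarExtension K K⸨X⸩ 𝔤) := (b.map e.symm).baseChange K⸨X⸩
  have hsurj : Function.Surjective fun z : E ↦ (1 : K) ⊗ₜ[K⟦X⟧] z :=
    TensorProduct.mk_surjective K⟦X⟧ E K fun k ↦ ⟨PowerSeries.C k, PowerSeries.constantCoeff_C k⟩
  choose v hv using fun i ↦ hsurj (σ.symm (βh i))
  have hvβ : (fun i ↦ (1 : K) ⊗ₜ[K⟦X⟧] v i) = βh.map σ.symm.toLinearEquiv := funext hv
  have hli : LinearIndependent K fun i ↦ (1 : K) ⊗ₜ[K⟦X⟧] v i := by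
    rw [hvβ]
    exact Module.Basis.linearIndependent _
  have hfd : FiniteDimensional K⸨X⸩ (ScalarExtension K⟦X⟧ K⸨X⸩ E) :=
    Module.Finite.of_basis (βg.map τ.symm.toLinearEquiv)
  have hrank : Module.finrank K⸨X⸩ (ScalarExtension K⟦X⟧ K⸨X⸩ E) = Fintype.card ι := by
    rw [← Module.finrank_eq_card_basis βg]
    exact τ.toLinearEquiv.finrank_eq
  let B : Module.Basis ι K⟦X⟧ E := Module.Basis.mk (linearIndependent_of_specialization hli)
    (span_eq_top_of_specialization K⸨X⸩ hli hrank).ge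
  have hB : ⇑B = v := Module.Basis.coe_mk _ _
  let c : ι × ι × ι → K⟦X⟧ := fun t ↦ B.repr ⁅v t.1, v t.2.1⁆ t.2.2
  have hc : HasStructConst v c := fun i j ↦ by
    rw [← hB]
    simp only [c, hB]
    rw [← hB]
    exact (B.sum_repr _).symm
  let w : Module.Basis ι K⸨X⸩ (ScalarExtension K K⸨X⸩ 𝔤) :=
    (B.baseChange K⸨X⸩).map τ.toLinearEquiv
  have hw : HasStructConst w (algebraMap K⟦X⟧ K⸨X⸩ ∘ c) := by
    have h := (hc.baseChange K⸨X⸩).map τ.toLieHom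
    convert h using 1
    funext i
    simp [w, hB]
  have hg : HasStructConst βg (algebraMap K K⸨X⸩ ∘ structConst b (point e)) := by
    have h := (hasStructConst_point b e).baseChange K⸨X⸩
    convert h using 1
    funext i
    simp [βg]
  have hh : HasStructConst βh (algebraMap K⟦X⟧ K ∘ c) := by
    have h := (hc.baseChange K).map σ.toLieHom
    convert h using 1
    funext i
    simp [hv]
  have hconst := hh.ext_const (hasStructConst_point b f) βh.linearIndependent
  refine ⟨c, βg.toMatrix w, w.toMatrix βg, βg.toMatrix_mul_toMatrix_flip w, hg.eq_actConst hw,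
    fun t ↦ congrFun hconst t⟩

end LieDegeneration

end

noncomputable section

/-! ### The Lie algebra with given structure constants -/

namespace LieDegeneration

attribute [local instance] specializationAlgebra

/-- The free module on `ι`, as the carrier of the bracket with structure constants `c`. It is kept
apart from `ι → R`, which has the commutator bracket of a product ring. -/
def ConstModule {ι R : Type*} (_c : ι × ι × ι → R) : Type _ := ι → R

namespace ConstModule

variable {ι R : Type*} [CommRing R] (c : ι × ι × ι → R)

instance : AddCommGroup (ConstModule c) := inferInstanceAs (AddCommGroup (ι → R))

instance : Module R (ConstModule c) := inferInstanceAs (Module R (ι → R))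

instance [IsDomain R] : Module.IsTorsionFree R (ConstModule c) :=
  inferInstanceAs (Module.IsTorsionFree R (ι → R))

variable [Fintype ι]

/-- The standard basis. -/
def basis : Module.Basis ι R (ConstModule c) := Pi.basisFun R ι

/-- The bilinear map with structure constants `c`. -/
def bracket : ConstModule c →ₗ[R] ConstModule c →ₗ[R] ConstModule c :=
  (basis c).constr R fun i ↦ (basis c).constr R fun j ↦ ∑ k, c (i, j, k) • basis c k

theorem bracket_basis (i j : ι) :
    bracket c (basis c i) (basis c j) = ∑ k, c (i, j, k) • basis c k := by
  rw [bracket, Module.Basis.constr_basis, Module.Basis.constr_basis]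

variable {c} {F L : Type*} [CommRing F] [LieRing L] [LieAlgebra F L] {w : ι → L} {f : R →+* F}

/-- The additive map that sends the standard basis of `ConstModule c` to `w`, semilinear along
`f`. -/
def toLie (w : ι → L) (f : R →+* F) : ConstModule c →ₛₗ[f] L where
  toFun x := ∑ i, f (basis c |>.repr x i) • w i
  map_add' x y := by simp [add_smul, Finset.sum_add_distrib]
  map_smul' r x := by simp [mul_smul, Finset.smul_sum]

theorem toLie_basis (i : ι) : toLie w f (basis c i) = w i := by
  classical
  simp [toLie, Finsupp.single_apply, apply_ite f]

theorem toLie_injective (hw : LinearIndependent F w) (hf : Function.Injective f) :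
    Function.Injective (toLie (c := c) w f) := by
  rw [injective_iff_map_eq_zero]
  intro x hx
  refine (basis c).ext_elem fun i ↦ hf ?_
  rw [map_zero, Finsupp.zero_apply, map_zero]
  exact Fintype.linearIndependent_iff.1 hw _ hx i

theorem toLie_bracket (h : HasStructConst w (f ∘ c)) (x y : ConstModule c) :
    toLie w f (bracket c x y) = ⁅toLie w f x, toLie w f y⁆ := by
  have h' : ∀ i j, ⁅w i, w j⁆ = ∑ k, f (c (i, j, k)) • w k := h
  rw [← (basis c).sum_repr x, ← (basis c).sum_repr y]
  simp only [map_sum, LinearMap.sum_apply, map_smul, LinearMap.smul_apply, LinearMap.map_smulₛₗ,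
    toLie_basis, bracket_basis, sum_lie, lie_sum, smul_lie, lie_smul, h']

/-- The Lie ring structure on `ConstModule c`, when `c` are the structure constants of a linearly
independent family of a Lie algebra over a larger ring. The Lie identities are inherited from
there. -/
abbrev lieRing (h : HasStructConst w (f ∘ c)) (hw : LinearIndependent F w)
    (hf : Function.Injective f) : LieRing (ConstModule c) :=
  { (inferInstance : AddCommGroup (ConstModule c)) with
    bracket := fun x y ↦ bracket c x y
    add_lie := fun x y z ↦ by
      change bracket c (x + y) z = bracket c x z + bracket c y z
      rw [map_add, LinearMap.add_apply]
    lie_add := fun x y z ↦ map_add (bracket c x) y z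
    lie_self := fun x ↦ toLie_injective hw hf (by
      rw [toLie_bracket h, lie_self, map_zero])
    leibniz_lie := fun x y z ↦ toLie_injective hw hf (by
      change toLie w f (bracket c x (bracket c y z)) =
        toLie w f (bracket c (bracket c x y) z + bracket c y (bracket c x z))
      simp only [map_add, toLie_bracket h]
      exact leibniz_lie _ _ _) }

/-- The Lie algebra structure that goes with `ConstModule.lieRing`. -/
abbrev lieAlgebra (h : HasStructConst w (f ∘ c)) (hw : LinearIndependent F w)
    (hf : Function.Injective f) :
    @LieAlgebra R (ConstModule c) _ (lieRing h hw hf) :=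
  letI := lieRing h hw hf
  { (inferInstance : Module R (ConstModule c)) with
    lie_smul := fun r x y ↦ map_smul (bracket c x) r y }

end ConstModule

/-- The curve of structure constants defines a formal deformation: its Lie identities hold in
`K⟦X⟧` because they hold over `K⸨X⸩`, where the bracket is that of `𝔤` in another basis. -/
theorem exists_formalDeformation {ι : Type x} {K : Type u} {V : Type v} {𝔤 : Type y} {𝔥 : Type w}
    [Fintype ι] [DecidableEq ι] [Field K] [AddCommGroup V] [Module K V]
    [LieRing 𝔤] [LieAlgebra K 𝔤] [LieRing 𝔥] [LieAlgebra K 𝔥]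
    (b : Module.Basis ι K V) (e : 𝔤 ≃ₗ[K] V) (f : 𝔥 ≃ₗ[K] V)
    {c : ι × ι × ι → K⟦X⟧} {M N : Matrix ι ι K⸨X⸩} (hMN : M * N = 1)
    (hc : algebraMap K⟦X⟧ K⸨X⸩ ∘ c = actConst M N (algebraMap K K⸨X⸩ ∘ structConst b (point e)))
    (hc0 : ∀ t, PowerSeries.constantCoeff (c t) = structConst b (point f) t) :
    ∃ D : FormalDeformation.{u, w, max u x} K 𝔥,
      Nonempty (ScalarExtension K⟦X⟧ K⸨X⸩ D.carrier ≃ₗ⁅K⸨X⸩⁆ ScalarExtension K K⸨X⸩ 𝔤) := by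
  let βg : Module.Basis ι K⸨X⸩ (ScalarExtension K K⸨X⸩ 𝔤) := (b.map e.symm).baseChange K⸨X⸩
  have hg : HasStructConst βg (algebraMap K K⸨X⸩ ∘ structConst b (point e)) := by
    have h := (hasStructConst_point b e).baseChange K⸨X⸩
    convert h using 1
    funext i
    simp [βg]
  obtain ⟨w, hw⟩ := hg.exists_basis_actConst hMN
  rw [← hc] at hw
  have hinj : Function.Injective (algebraMap K⟦X⟧ K⸨X⸩) := IsFractionRing.injective _ _
  let _ : LieRing (ConstModule c) := ConstModule.lieRing hw w.linearIndependent hinj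
  let _ : LieAlgebra K⟦X⟧ (ConstModule c) := ConstModule.lieAlgebra hw w.linearIndependent hinj
  have hB : HasStructConst (ConstModule.basis c) c := ConstModule.bracket_basis c
  have hBK : HasStructConst (R := K) (L := ScalarExtension K⟦X⟧ K (ConstModule c))
      ((ConstModule.basis c).baseChange K) (structConst b (point f)) := by
    have h := hB.baseChange K
    rw [show algebraMap K⟦X⟧ K ∘ c = structConst b (point f) from funext hc0] at h
    convert h using 1
    funext i
    simp
  have hBL : HasStructConst (R := K⸨X⸩) (L := ScalarExtension K⟦X⟧ K⸨X⸩ (ConstModule c))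
      ((ConstModule.basis c).baseChange K⸨X⸩) (algebraMap K⟦X⟧ K⸨X⸩ ∘ c) := by
    have h := hB.baseChange K⸨X⸩
    convert h using 1
    funext i
    simp
  obtain ⟨σ⟩ := hBK.nonempty_lieEquiv (hasStructConst_point b f)
  exact ⟨{ carrier := ConstModule c
           complete := isAdicComplete_span_singleton_pi (ι := ι) (PowerSeries.X : K⟦X⟧)
           torsionFree := inferInstance
           specialization := σ }, hBL.nonempty_lieEquiv hw⟩

theorem isDegeneration_point_iff {K V L : Type*} [Field K] [AddCommGroup V] [Module K V]
    [LieRing L] [LieAlgebra K L] (f : L ≃ₗ[K] V) (φ : Bilin K V) :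
    IsDegeneration (point f) φ ↔
      ∀ f' : L ≃ₗ[K] V, point f' ∈ zariskiClosure K (orbit φ) := by
  have hlie : ∀ f' : L ≃ₗ[K] V, point f' ∈ lieVariety K V := fun f' ↦ by
    refine ⟨fun a ↦ ?_, fun a b c ↦ ?_⟩
    · rw [point_apply, lie_self, map_zero]
    · simp only [point_apply, LinearEquiv.symm_apply_apply, ← map_add]
      rw [lie_jacobi, map_zero]
  constructor
  · intro h f'
    refine (h ⟨f.symm.trans f', ?_⟩).2
    ext a b
    simp [point_apply, transport_apply]
  · rintro h _ ⟨g, rfl⟩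
    have hg : transport g (point f) = point (f.trans g) := rfl
    rw [hg]
    exact ⟨hlie _, h _⟩

end LieDegeneration

end

theorem theorem5p1 {K : Type u} [Field K] [IsAlgClosed K]
    {V : Type v} [AddCommGroup V] [Module K V] [FiniteDimensional K V]
    {𝔤 : Type y} [LieRing 𝔤] [LieAlgebra K 𝔤] {𝔥 : Type w} [LieRing 𝔥] [LieAlgebra K 𝔥]
    (e : 𝔤 ≃ₗ[K] V) (f : 𝔥 ≃ₗ[K] V) :
    LieDegeneration.IsDegeneration (LieDegeneration.point f) (LieDegeneration.point e) ↔
      ∃ D : LieDegeneration.FormalDeformation.{u, w, max u x} K 𝔥,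
        Nonempty (LieDegeneration.ScalarExtension K⟦X⟧ K⸨X⸩ D.carrier ≃ₗ⁅K⸨X⸩⁆
          LieDegeneration.ScalarExtension K K⸨X⸩ 𝔤) := by
  -- the lift puts the carrier of the deformation into the required universe
  let b : Module.Basis (ULift.{x} (Fin (Module.finrank K V))) K V :=
    (Module.finBasis K V).reindex Equiv.ulift.symm
  rw [LieDegeneration.isDegeneration_point_iff]
  constructor
  · intro h
    obtain ⟨c, M, N, hMN, hc, hc0⟩ :=
      (LieDegeneration.mem_zariskiClosure_orbit_iff b _ _).1 (h f)
    exact LieDegeneration.exists_formalDeformation b e f hMN hc hc0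
  · rintro ⟨D, ⟨τ⟩⟩ f'
    have := D.torsionFree
    exact (LieDegeneration.mem_zariskiClosure_orbit_iff b _ _).2
      (LieDegeneration.exists_curve_of_formalDeformation b e f' D.specialization τ)
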